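/- Let $(N^3,h)$ be a smooth Riemannian $3$-manifold with nonpositive sectional curvature, let $(M^2,g)$ be a smooth Riemannian surface, and let $\varphi:(M^2,g)\to(N^3,h)$ be an isometric immersion ($g=\varphi^*h$) that is totally umbilical, i.e. its second fundamental form $B=\nabla d\varphi$ satisfies $B(X,Y)=g(X,Y)\,\eta$ with $\eta=\tfrac12\operatorname{Trace}_g B$ the mean curvature vector field. Let $\lambda:M\to(0,\infty)$ be a function such that $\bar g=\lambda^{-2}g$ is a smooth Riemannian metric on $M$, and suppose that the conformal immersion $\varphi:(M^2,\bar g)\to(N^3,h)$ is biharmonic, i.e. its bitension field $$\tau_2(\varphi)=\operatorname{Trace}_{\bar g}\bigl(\nabla^{\varphi}\nabla^{\varphi}-\nabla^{\varphi}_{\nabla^{M}}\bigr)\tau(\varphi)-\operatorname{Trace}_{\bar g}R^{N}(d\varphi,\tau(\varphi))d\varphi$$ vanishes identically, where $\tau(\varphi)=\operatorname{Trace}_{\bar g}\nabla d\varphi$ is the tension field, $\nabla^M$ and $\nabla d\varphi$ are here taken with respect to $\bar g$ (and $h$), and $R^N(X,Y)Z=[\nabla^N_X,\nabla^N_Y]Z-\nabla^N_{[X,Y]}Z$.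 Then $\varphi:(M^2,\bar g)\to(N^3,h)$ is harmonic, i.e. $\tau(\varphi)\equiv 0$. Moreover, the surface $\varphi:(M^2,g)\to(N^3,h)$ is totally geodesic, i.e. $B\equiv 0$. -/

import Mathlib

open scoped Manifold ContDiff

noncomputable section

/-- The coordinate space `ℝⁿ` on which the manifolds of dimension `n` are modelled. -/
abbrev Coord (n : ℕ) : Type := EuclideanSpace ℝ (Fin n)

/-- A smooth (`C^∞`) Riemannian metric on a smooth manifold of dimension `n`. -/
abbrev SmoothMetric (n : ℕ) (M : Type*) [TopologicalSpace M] [ChartedSpace (Coord n) M]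
    [IsManifold (𝓡 n) ∞ M] : Type _ :=
  Bundle.ContMDiffRiemannianMetric (𝓡 n) ∞ (Coord n) (fun x : M => TangentSpace (𝓡 n) x)

/-- A chart of the maximal smooth atlas of `M` (a local coordinate system). -/
def IsSmoothChart (n : ℕ) {M : Type*} [TopologicalSpace M] [ChartedSpace (Coord n) M]
    (e : OpenPartialHomeomorph M (Coord n)) : Prop :=
  e ∈ IsManifold.maximalAtlas (𝓡 n) ∞ M

/-! ### Riemannian geometry in local coordinates -/

namespace LocalGeom

variable {m n : ℕ}

/-- The partial derivative `∂ᵢ f` of a real function of `m` variables. -/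
def pd (i : Fin m) (f : Coord m → ℝ) (p : Coord m) : ℝ :=
  fderiv ℝ f p (EuclideanSpace.single i 1)

/-- The Christoffel symbol `Γᵏᵢⱼ = ½ ∑ₗ gᵏˡ (∂ᵢ gⱼₗ + ∂ⱼ gᵢₗ - ∂ₗ gᵢⱼ)` of the Levi-Civita
connection of the metric with coefficient matrix `G`. -/
def christoffel (G : Coord m → Matrix (Fin m) (Fin m) ℝ) (k i j : Fin m) (p : Coord m) : ℝ :=
  (1 / 2) * ∑ l, (G p)⁻¹ k l *
    (pd i (fun q => G q j l) p + pd j (fun q => G q i l) p - pd l (fun q => G q i j) p)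

/-- The component `Rˡₖᵢⱼ` of the curvature tensor: `R(∂ᵢ, ∂ⱼ) ∂ₖ = ∑ₗ Rˡₖᵢⱼ ∂ₗ`, where
`R(X, Y) Z = ∇_X ∇_Y Z - ∇_Y ∇_X Z - ∇_{[X, Y]} Z`. -/
def curvatureComponent (G : Coord m → Matrix (Fin m) (Fin m) ℝ) (l k i j : Fin m)
    (p : Coord m) : ℝ :=
  pd i (christoffel G l j k) p - pd j (christoffel G l i k) p +
    ∑ a, (christoffel G l i a p * christoffel G a j k p -
      christoffel G l j a p * christoffel G a i k p)

/-- The curvature operator: the coordinate vector of `R(X, Y) Z` at `p`. -/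
def curvatureOperator (G : Coord m → Matrix (Fin m) (Fin m) ℝ) (p : Coord m)
    (X Y Z : Fin m → ℝ) (l : Fin m) : ℝ :=
  ∑ k, ∑ i, ∑ j, curvatureComponent G l k i j p * X i * Y j * Z k

/-- The inner product `⟨X, Y⟩` at `p` of two vectors given in coordinates. -/
def metricInner (G : Coord m → Matrix (Fin m) (Fin m) ℝ) (p : Coord m) (X Y : Fin m → ℝ) : ℝ :=
  ∑ i, ∑ j, G p i j * X i * Y j

/-- The sectional curvature `⟨R(X, Y) Y, X⟩ / (|X|² |Y|² - ⟨X, Y⟩²)` of the plane spanned by `X`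
and `Y` at `p`; it is only used for linearly independent `X` and `Y`. -/
def sectionalCurvature (G : Coord m → Matrix (Fin m) (Fin m) ℝ) (p : Coord m)
    (X Y : Fin m → ℝ) : ℝ :=
  metricInner G p (curvatureOperator G p X Y Y) X /
    (metricInner G p X X * metricInner G p Y Y - metricInner G p X Y ^ 2)

/-- The vector `du(∂ᵢ)`, with components `∂ᵢ u^α`. -/
def push (u : Coord m → Coord n) (i : Fin m) (p : Coord m) (α : Fin n) : ℝ :=
  pd i (fun q => u q α) p

/-- The connection `∇^u` induced on vector fields along the map `u` by the Levi-Civita connection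
of the target metric `H`: `(∇^u_{∂ᵢ} V)^α = ∂ᵢ V^α + ∑ Γ^α_{βγ}(u) ∂ᵢ u^β V^γ`. -/
def covAlong (H : Coord n → Matrix (Fin n) (Fin n) ℝ) (u : Coord m → Coord n) (i : Fin m)
    (V : Coord m → Fin n → ℝ) (p : Coord m) (α : Fin n) : ℝ :=
  pd i (fun q => V q α) p +
    ∑ β, ∑ γ, christoffel H α β γ (u p) * push u i p β * V p γ

/-- The second fundamental form of the map `u`, i.e. the Hessian
`∇du(∂ᵢ, ∂ⱼ) = ∇^u_{∂ᵢ}(du(∂ⱼ)) - du(∇_{∂ᵢ} ∂ⱼ)`. For an isometric immersion this is the second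
fundamental form of the immersed submanifold. -/
def secondForm (G : Coord m → Matrix (Fin m) (Fin m) ℝ) (H : Coord n → Matrix (Fin n) (Fin n) ℝ)
    (u : Coord m → Coord n) (i j : Fin m) (p : Coord m) (α : Fin n) : ℝ :=
  covAlong H u i (push u j) p α - ∑ k, christoffel G k i j p * push u k p α

/-- The tension field `τ(u) = Trace_g ∇du`. -/
def tension (G : Coord m → Matrix (Fin m) (Fin m) ℝ) (H : Coord n → Matrix (Fin n) (Fin n) ℝ)
    (u : Coord m → Coord n) (p : Coord m) (α : Fin n) : ℝ :=
  ∑ i, ∑ j, (G p)⁻¹ i j * secondForm G H u i j p α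

/-- The rough Laplacian `Trace_g (∇^u ∇^u - ∇^u_{∇^M}) V` of a vector field `V` along `u`. -/
def roughLaplacian (G : Coord m → Matrix (Fin m) (Fin m) ℝ)
    (H : Coord n → Matrix (Fin n) (Fin n) ℝ) (u : Coord m → Coord n)
    (V : Coord m → Fin n → ℝ) (p : Coord m) (α : Fin n) : ℝ :=
  ∑ i, ∑ j, (G p)⁻¹ i j * (covAlong H u i (covAlong H u j V) p α -
    ∑ k, christoffel G k i j p * covAlong H u k V p α)

/-- The bitension field
`τ₂(u) = Trace_g (∇^u ∇^u - ∇^u_{∇^M}) τ(u) - Trace_g Rᴺ(du, τ(u)) du`. -/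
def bitension (G : Coord m → Matrix (Fin m) (Fin m) ℝ) (H : Coord n → Matrix (Fin n) (Fin n) ℝ)
    (u : Coord m → Coord n) (p : Coord m) (α : Fin n) : ℝ :=
  roughLaplacian G H u (tension G H u) p α -
    ∑ i, ∑ j, (G p)⁻¹ i j *
      curvatureOperator H (u p) (push u i p) (tension G H u p) (push u j p) α

end LocalGeom

/-! ### Passage to manifolds -/

section Manifold

variable {m n : ℕ}
  {M : Type*} [TopologicalSpace M] [ChartedSpace (Coord m) M] [IsManifold (𝓡 m) ∞ M]
  {N : Type*} [TopologicalSpace N] [ChartedSpace (Coord n) N] [IsManifold (𝓡 n) ∞ N]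

/-- The coordinate vector field `∂ᵢ` of the chart `e`, at the point with coordinates `p`. -/
def coordVector (e : OpenPartialHomeomorph M (Coord m)) (i : Fin m) (p : Coord m) :
    TangentSpace (𝓡 m) (e.symm p) :=
  mfderiv (𝓡 m) (𝓡 m) e.symm p (EuclideanSpace.single i (1 : ℝ) : Coord m)

/-- The coefficient matrix `gᵢⱼ = g(∂ᵢ, ∂ⱼ)` of the metric `g` in the chart `e`, as a function of
the coordinates (meaningful on `e.target`). -/
def metricInChart (g : SmoothMetric m M) (e : OpenPartialHomeomorph M (Coord m)) (p : Coord m) :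
    Matrix (Fin m) (Fin m) ℝ :=
  Matrix.of fun i j => g.inner (e.symm p) (coordVector e i p) (coordVector e j p)

/-- The coordinate expression `e' ∘ φ ∘ e⁻¹` of a map `φ` between manifolds. -/
def mapInCharts (φ : M → N) (e : OpenPartialHomeomorph M (Coord m))
    (e' : OpenPartialHomeomorph N (Coord n)) : Coord m → Coord n :=
  fun p => e' (φ (e.symm p))

/-- `(N, h)` is nonpositively curved: the sectional curvature of every tangent plane is `≤ 0`. -/
def NonpositivelyCurved (h : SmoothMetric n N) : Prop :=
  ∀ e : OpenPartialHomeomorph N (Coord n), IsSmoothChart n e → ∀ p ∈ e.target,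
    ∀ X Y : Fin n → ℝ, LinearIndependent ℝ ![X, Y] →
      LocalGeom.sectionalCurvature (metricInChart h e) p X Y ≤ 0

/-- `φ : (M, g) → (N, h)` is a (smooth) isometric immersion: `g = φ^* h`. The differential is
then automatically injective, as `g` is positive definite. -/
def IsIsometricImmersion (g : SmoothMetric m M) (h : SmoothMetric n N) (φ : M → N) : Prop :=
  ContMDiff (𝓡 m) (𝓡 n) ∞ φ ∧
    ∀ (x : M) (v w : TangentSpace (𝓡 m) x),
      h.inner (φ x) (mfderiv (𝓡 m) (𝓡 n) φ x v) (mfderiv (𝓡 m) (𝓡 n) φ x w) = g.inner x v w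

/-- A condition `P e e' p` on the coordinate expression of `φ` holds at all points of `M`, in all
smooth charts `e` of `M` and `e'` of `N` around the point and its image. -/
def InAllCharts (φ : M → N)
    (P : OpenPartialHomeomorph M (Coord m) → OpenPartialHomeomorph N (Coord n) →
      Coord m → Prop) : Prop :=
  ∀ (e : OpenPartialHomeomorph M (Coord m)) (e' : OpenPartialHomeomorph N (Coord n)),
    IsSmoothChart m e → IsSmoothChart n e' →
      ∀ p ∈ e.target, φ (e.symm p) ∈ e'.source → P e e' p

/-- `φ : (M, g) → (N, h)` is harmonic: `τ(φ) = 0`. -/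
def IsHarmonicMap (g : SmoothMetric m M) (h : SmoothMetric n N) (φ : M → N) : Prop :=
  InAllCharts φ fun e e' p => ∀ α,
    LocalGeom.tension (metricInChart g e) (metricInChart h e') (mapInCharts φ e e') p α = 0

/-- `φ : (M, g) → (N, h)` is biharmonic: `τ₂(φ) = 0`. -/
def IsBiharmonicMap (g : SmoothMetric m M) (h : SmoothMetric n N) (φ : M → N) : Prop :=
  InAllCharts φ fun e e' p => ∀ α,
    LocalGeom.bitension (metricInChart g e) (metricInChart h e') (mapInCharts φ e e') p α = 0

/-- An isometric immersion `φ : (M, g) → (N, h)` is totally umbilical: its second fundamental form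
is `B(X, Y) = g(X, Y) η`, with `η = (1/m) Trace_g B` the mean curvature vector field. -/
def IsTotallyUmbilical (g : SmoothMetric m M) (h : SmoothMetric n N) (φ : M → N) : Prop :=
  InAllCharts φ fun e e' p => ∀ i j α,
    LocalGeom.secondForm (metricInChart g e) (metricInChart h e') (mapInCharts φ e e') i j p α =
      metricInChart g e p i j * ((1 / (m : ℝ)) *
        LocalGeom.tension (metricInChart g e) (metricInChart h e') (mapInCharts φ e e') p α)

/-- An isometric immersion `φ : (M, g) → (N, h)` is totally geodesic: its second fundamental form
vanishes. -/
def IsTotallyGeodesic (g : SmoothMetric m M) (h : SmoothMetric n N) (φ : M → N) : Prop :=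
  InAllCharts φ fun e e' p => ∀ i j α,
    LocalGeom.secondForm (metricInChart g e) (metricInChart h e') (mapInCharts φ e e') i j p α = 0

/-- `gbar = λ⁻² g` with `λ : M → (0, ∞)`. If `φ : (M, g) → (N, h)` is an isometric immersion,
then `φ : (M, gbar) → (N, h)` is a conformal immersion with conformal factor `λ`. -/
def IsConformalRescaling (g gbar : SmoothMetric m M) (lam : M → ℝ) : Prop :=
  (∀ x, 0 < lam x) ∧
    ∀ (x : M) (v w : TangentSpace (𝓡 m) x), gbar.inner x v w = (lam x ^ 2)⁻¹ * g.inner x v w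

end Manifold

end

/-!
On a surface, the Christoffel symbols of `ḡ = c g` and `g` have traces proportional by `c⁻¹`, so the
tension field and the Jacobi operator of a map both scale by `c⁻¹`. Hence biharmonicity of
`φ : (M, ḡ) → (N, h)` says that the normal field `w = 2 c⁻¹ η` is a Jacobi field of the umbilical
surface `φ : (M, g) → (N, h)`. For a normal field `w` along an `m`-dimensional umbilical immersion,
the tangential part of the Jacobi operator is `(m - 2) ∇⟨w, η⟩ - m ⟨∇w, η⟩`; for `m = 2` its
vanishing gives `⟨∇w, η⟩ = 0`, so that `|w|²` is constant. In nonpositive curvature the Bochner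
formula then forces `|∇w|² ≤ 0`. The tangential part of `∇w` is `-⟨w, η⟩ dφ`, so `⟨w, η⟩ = 0`, and
as `w` is a positive multiple of `η` this means `η = 0`.
-/

open scoped Matrix

/-! ### Traces with respect to a metric -/

section MetricTrace

variable {ι E F : Type*} [Fintype ι] [DecidableEq ι] [AddCommGroup E] [Module ℝ E]
  [AddCommGroup F] [Module ℝ F]

/-- The trace `∑ gⁱʲ Tᵢⱼ` of a two-tensor `T` with values in `E` with respect to the metric with
coefficient matrix `g`; the indices are raised by the inverse matrix. -/
noncomputable def metricTrace (g : Matrix ι ι ℝ) (T : ι → ι → E) : E :=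
  ∑ i, ∑ j, g⁻¹ i j • T i j

variable {g : Matrix ι ι ℝ}

lemma metricTrace_add (S T : ι → ι → E) :
    metricTrace g (fun i j => S i j + T i j) = metricTrace g S + metricTrace g T := by
  simp only [metricTrace, smul_add, Finset.sum_add_distrib]

lemma map_metricTrace (L : E →ₗ[ℝ] F) (T : ι → ι → E) :
    L (metricTrace g T) = metricTrace g fun i j => L (T i j) := by
  simp only [metricTrace, map_sum, map_smul]

lemma metricTrace_neg (T : ι → ι → E) :
    metricTrace g (fun i j => -T i j) = -metricTrace g T := by
  simp only [metricTrace, smul_neg, Finset.sum_neg_distrib]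

lemma metricTrace_sub (S T : ι → ι → E) :
    metricTrace g (fun i j => S i j - T i j) = metricTrace g S - metricTrace g T := by
  simp only [metricTrace, smul_sub, Finset.sum_sub_distrib]

lemma metricTrace_smul (a : ℝ) (T : ι → ι → E) :
    metricTrace g (fun i j => a • T i j) = a • metricTrace g T := by
  simp only [metricTrace, smul_comm _ a, Finset.smul_sum]

lemma metricTrace_smul_const (a : ι → ι → ℝ) (x : E) :
    metricTrace g (fun i j => a i j • x) = metricTrace g a • x :=
  (map_metricTrace (LinearMap.toSpanSingleton ℝ E x) a).symm

lemma metricTrace_sum {κ : Type*} (s : Finset κ) (T : κ → ι → ι → E) :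
    metricTrace g (fun i j => ∑ k ∈ s, T k i j) = ∑ k ∈ s, metricTrace g (T k) := by
  simp only [metricTrace, Finset.smul_sum]
  exact (Finset.sum_congr rfl fun _ _ => Finset.sum_comm).trans Finset.sum_comm

lemma metricTrace_apply {κ : Type*} (T : ι → ι → κ → ℝ) (k : κ) :
    metricTrace g T k = metricTrace g fun i j => T i j k :=
  map_metricTrace (LinearMap.proj (R := ℝ) (φ := fun _ : κ => ℝ) k) T

lemma inv_smul_of_posDef (hg : g.PosDef) {c : ℝ} (hc : c ≠ 0) : (c • g)⁻¹ = c⁻¹ • g⁻¹ :=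
  Matrix.inv_smul' g (Units.mk0 c hc) ((Matrix.isUnit_iff_isUnit_det g).1 hg.isUnit)

lemma metricTrace_smul_metric (hg : g.PosDef) {c : ℝ} (hc : c ≠ 0) (T : ι → ι → E) :
    metricTrace (c • g) T = c⁻¹ • metricTrace g T := by
  simp only [metricTrace, inv_smul_of_posDef hg hc, Matrix.smul_apply, smul_eq_mul, mul_smul,
    Finset.smul_sum]

lemma sum_inv_mul_of_posDef (hg : g.PosDef) (i k : ι) :
    ∑ j, g⁻¹ i j * g j k = if i = k then 1 else 0 := by
  rw [← Matrix.mul_apply, Matrix.nonsing_inv_mul _ ((Matrix.isUnit_iff_isUnit_det g).1 hg.isUnit),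
    Matrix.one_apply]

lemma metricTrace_metric_smul_left (hg : g.PosDef) (v : ι → E) (k : ι) :
    metricTrace g (fun i j => g j k • v i) = v k := by
  simp only [metricTrace, smul_smul, ← Finset.sum_smul, sum_inv_mul_of_posDef hg, ite_smul,
    one_smul, zero_smul, Finset.sum_ite_eq', Finset.mem_univ, if_true]

lemma metricTrace_swap (hg : g.PosDef) (T : ι → ι → E) :
    metricTrace g (fun i j => T j i) = metricTrace g T := by
  rw [metricTrace, Finset.sum_comm]
  refine Finset.sum_congr rfl fun i _ => Finset.sum_congr rfl fun j _ => ?_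
  rw [show g⁻¹ j i = g⁻¹ i j by simpa using hg.inv.isHermitian.apply i j]

lemma metricTrace_metric_smul_right (hg : g.PosDef) (v : ι → E) (k : ι) :
    metricTrace g (fun i j => g i k • v j) = v k :=
  (metricTrace_swap hg _).symm.trans (metricTrace_metric_smul_left hg v k)

lemma metricTrace_metric (hg : g.PosDef) : metricTrace g (fun i j => g i j) = Fintype.card ι := by
  rw [← metricTrace_swap hg]
  simp [metricTrace, sum_inv_mul_of_posDef hg]

lemma metricTrace_nonneg (hg : g.PosDef) (S : LinearMap.BilinForm ℝ E) (hS : ∀ x, 0 ≤ S x x)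
    (X : ι → E) : 0 ≤ metricTrace g fun i j => S (X i) (X j) := by
  obtain ⟨B, hB⟩ : ∃ B : Matrix ι ι ℝ, g⁻¹ = star B * B := by
    open scoped MatrixOrder in
    exact CStarAlgebra.nonneg_iff_eq_star_mul_self.1 hg.inv.posSemidef.nonneg
  have sum_squares : (metricTrace g fun i j => S (X i) (X j)) =
      ∑ k, S (∑ i, B k i • X i) (∑ i, B k i • X i) := by
    simp only [metricTrace, hB, Matrix.mul_apply, Matrix.star_apply, star_trivial, smul_eq_mul,
      map_sum, map_smul, LinearMap.sum_apply, LinearMap.smul_apply, Finset.mul_sum, Finset.sum_mul]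
    rw [Finset.sum_comm_cycle]
    refine Finset.sum_congr rfl fun k _ => ?_
    rw [Finset.sum_comm]
    exact Finset.sum_congr rfl fun i _ => Finset.sum_congr rfl fun j _ => by ring
  rw [sum_squares]
  exact Finset.sum_nonneg fun k _ => hS _

end MetricTrace

namespace LocalGeom

variable {m n : ℕ}

/-! ### Partial derivatives -/

section PartialDerivatives

variable {f g : Coord m → ℝ} {U : Set (Coord m)} {p : Coord m}

lemma differentiableAt_of_contDiffOn (hU : IsOpen U) (hf : ContDiffOn ℝ ∞ f U) (hp : p ∈ U) :
    DifferentiableAt ℝ f p :=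
  (hf.contDiffAt (hU.mem_nhds hp)).differentiableAt (by simp)

lemma contDiffOn_pd (hU : IsOpen U) (hf : ContDiffOn ℝ ∞ f U) (i : Fin m) :
    ContDiffOn ℝ ∞ (pd i f) U :=
  (hf.fderiv_of_isOpen hU (by simp)).clm_apply contDiffOn_const

lemma pd_congr (hU : IsOpen U) (hp : p ∈ U) (h : Set.EqOn f g U) (i : Fin m) :
    pd i f p = pd i g p := by
  rw [pd, (h.eventuallyEq_of_mem (hU.mem_nhds hp)).fderiv_eq, pd]

lemma pd_const (i : Fin m) (c : ℝ) : pd i (fun _ => c) p = 0 := by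
  simp [pd]

lemma pd_add (i : Fin m) (hf : DifferentiableAt ℝ f p) (hg : DifferentiableAt ℝ g p) :
    pd i (fun q => f q + g q) p = pd i f p + pd i g p := by
  simp [pd, fderiv_fun_add hf hg]

lemma pd_mul (i : Fin m) (hf : DifferentiableAt ℝ f p) (hg : DifferentiableAt ℝ g p) :
    pd i (fun q => f q * g q) p = pd i f p * g p + f p * pd i g p := by
  simp [pd, fderiv_fun_mul hf hg]
  ring

lemma pd_sum {ι : Type*} (s : Finset ι) {F : ι → Coord m → ℝ} (i : Fin m)
    (hF : ∀ a ∈ s, DifferentiableAt ℝ (F a) p) :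
    pd i (fun q => ∑ a ∈ s, F a q) p = ∑ a ∈ s, pd i (F a) p := by
  simp [pd, fderiv_fun_sum hF]

lemma pd_pd (hf : ContDiffAt ℝ 2 f p) (i j : Fin m) :
    pd i (pd j f) p =
      fderiv ℝ (fderiv ℝ f) p (EuclideanSpace.single i 1) (EuclideanSpace.single j 1) := by
  have hd : DifferentiableAt ℝ (fderiv ℝ f) p :=
    (hf.fderiv_right (m := 1) (by norm_cast)).differentiableAt (by simp)
  change fderiv ℝ (fun q => fderiv ℝ f q (EuclideanSpace.single j 1)) p _ = _
  rw [fderiv_clm_apply hd (differentiableAt_const _)]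
  simp

lemma pd_comm (hf : ContDiffAt ℝ 2 f p) (i j : Fin m) : pd i (pd j f) p = pd j (pd i f) p := by
  rw [pd_pd hf, pd_pd hf]
  exact (hf.isSymmSndFDerivAt (by simp)).eq _ _

lemma sum_smul_single (v : Coord m) : ∑ i, v i • EuclideanSpace.single i (1 : ℝ) = v := by
  ext a
  simp [Finset.sum_apply, Pi.single_apply]

lemma fderiv_apply_eq_sum_pd (v : Coord m) : fderiv ℝ f p v = ∑ i, pd i f p * v i := by
  conv_lhs => rw [← sum_smul_single v]
  simp [pd, mul_comm]

lemma toLp_push {u : Coord m → Coord n} (hu : DifferentiableAt ℝ u p) (i : Fin m) :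
    (WithLp.toLp 2 (push u i p) : Coord n) = fderiv ℝ u p (EuclideanSpace.single i 1) := by
  ext α
  have := (EuclideanSpace.proj α : Coord n →L[ℝ] ℝ).hasFDerivAt.comp p hu.hasFDerivAt
  change fderiv ℝ (EuclideanSpace.proj α ∘ u) p _ = _
  rw [this.fderiv]
  rfl

lemma pd_comp {F : Coord n → ℝ} {u : Coord m → Coord n} (i : Fin m)
    (hF : DifferentiableAt ℝ F (u p)) (hu : DifferentiableAt ℝ u p) :
    pd i (fun q => F (u q)) p = ∑ c, pd c F (u p) * push u i p c := by
  change fderiv ℝ (F ∘ u) p _ = _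
  rw [fderiv_comp p hF hu, ContinuousLinearMap.comp_apply, ← toLp_push hu, fderiv_apply_eq_sum_pd]

end PartialDerivatives

/-! ### The inner product -/

section MetricInner

variable {G : Coord m → Matrix (Fin m) (Fin m) ℝ} {p : Coord m}

lemma metricInner_eq_toBilin' (X Y : Fin m → ℝ) :
    metricInner G p X Y = Matrix.toBilin' (G p) X Y := by
  simp only [metricInner, Matrix.toBilin'_apply, mul_comm (X _)]

lemma metricInner_add_left (X Y Z : Fin m → ℝ) :
    metricInner G p (X + Y) Z = metricInner G p X Z + metricInner G p Y Z := by
  simp [metricInner_eq_toBilin']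

lemma metricInner_add_right (X Y Z : Fin m → ℝ) :
    metricInner G p X (Y + Z) = metricInner G p X Y + metricInner G p X Z := by
  simp [metricInner_eq_toBilin']

lemma metricInner_neg_left (X Z : Fin m → ℝ) :
    metricInner G p (-X) Z = -metricInner G p X Z := by
  simp [metricInner_eq_toBilin']

lemma metricInner_sub_left (X Y Z : Fin m → ℝ) :
    metricInner G p (X - Y) Z = metricInner G p X Z - metricInner G p Y Z := by
  simp [metricInner_eq_toBilin']

lemma metricInner_sub_right (X Y Z : Fin m → ℝ) :
    metricInner G p X (Y - Z) = metricInner G p X Y - metricInner G p X Z := by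
  simp [metricInner_eq_toBilin']

lemma metricInner_smul_left (c : ℝ) (X Z : Fin m → ℝ) :
    metricInner G p (c • X) Z = c * metricInner G p X Z := by
  simp [metricInner_eq_toBilin']

lemma metricInner_smul_right (c : ℝ) (X Z : Fin m → ℝ) :
    metricInner G p X (c • Z) = c * metricInner G p X Z := by
  simp [metricInner_eq_toBilin']

lemma metricInner_sum_left {ι : Type*} (s : Finset ι) (X : ι → Fin m → ℝ) (Z : Fin m → ℝ) :
    metricInner G p (∑ a ∈ s, X a) Z = ∑ a ∈ s, metricInner G p (X a) Z := by
  simp [metricInner_eq_toBilin']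

lemma metricInner_sum_right {ι : Type*} (s : Finset ι) (X : Fin m → ℝ) (Z : ι → Fin m → ℝ) :
    metricInner G p X (∑ a ∈ s, Z a) = ∑ a ∈ s, metricInner G p X (Z a) := by
  simp [metricInner_eq_toBilin']

lemma metricInner_metricTrace {ι : Type*} [Fintype ι] [DecidableEq ι] (g : Matrix ι ι ℝ)
    (T : ι → ι → Fin m → ℝ) (Z : Fin m → ℝ) :
    metricInner G p (metricTrace g T) Z = metricTrace g fun i j => metricInner G p (T i j) Z := by
  simp only [metricInner_eq_toBilin']
  exact map_metricTrace ((Matrix.toBilin' (G p)).flip Z) T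

end MetricInner

/-! ### Metrics and their Christoffel symbols -/

/-- The matrix-valued function `G` is the coefficient matrix of a smooth Riemannian metric on the
open set `U` of coordinate space. -/
structure IsMetricOn (G : Coord m → Matrix (Fin m) (Fin m) ℝ) (U : Set (Coord m)) : Prop where
  isOpen : IsOpen U
  contDiffOn : ∀ i j, ContDiffOn ℝ ∞ (fun q => G q i j) U
  posDef : ∀ p ∈ U, (G p).PosDef

lemma contDiffOn_det {A : Coord m → Matrix (Fin n) (Fin n) ℝ} {U : Set (Coord m)}
    (hA : ∀ i j, ContDiffOn ℝ ∞ (fun q => A q i j) U) :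
    ContDiffOn ℝ ∞ (fun q => (A q).det) U := by
  simp only [Matrix.det_apply]
  exact ContDiffOn.sum fun σ _ =>
    ContDiffOn.const_smul _ (contDiffOn_prod fun i _ => hA _ _)

lemma contDiffOn_inv {A : Coord m → Matrix (Fin n) (Fin n) ℝ} {U : Set (Coord m)}
    (hA : ∀ i j, ContDiffOn ℝ ∞ (fun q => A q i j) U) (hdet : ∀ q ∈ U, (A q).det ≠ 0)
    (k l : Fin n) : ContDiffOn ℝ ∞ (fun q => (A q)⁻¹ k l) U := by
  simp only [Matrix.inv_def, Ring.inverse_eq_inv', Matrix.smul_apply, smul_eq_mul,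
    Matrix.adjugate_apply]
  refine ((contDiffOn_det hA).inv hdet).mul (contDiffOn_det fun i j => ?_)
  rcases eq_or_ne i l with rfl | hil
  · simpa only [Matrix.updateRow_self] using contDiffOn_const
  · simpa only [Matrix.updateRow_ne hil] using hA i j

namespace IsMetricOn

variable {G : Coord m → Matrix (Fin m) (Fin m) ℝ} {U W : Set (Coord m)} {p : Coord m}

lemma mono (hG : IsMetricOn G U) (hW : IsOpen W) (hWU : W ⊆ U) : IsMetricOn G W where
  isOpen := hW
  contDiffOn i j := (hG.contDiffOn i j).mono hWU
  posDef q hq := hG.posDef q (hWU hq)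

lemma symm (hG : IsMetricOn G U) (hp : p ∈ U) (i j : Fin m) : G p i j = G p j i := by
  simpa using (hG.posDef p hp).isHermitian.apply j i

lemma differentiableAt (hG : IsMetricOn G U) (hp : p ∈ U) (i j : Fin m) :
    DifferentiableAt ℝ (fun q => G q i j) p :=
  differentiableAt_of_contDiffOn hG.isOpen (hG.contDiffOn i j) hp

lemma pd_symm (hG : IsMetricOn G U) (hp : p ∈ U) (k i j : Fin m) :
    pd k (fun q => G q i j) p = pd k (fun q => G q j i) p :=
  pd_congr hG.isOpen hp (fun _ hq => hG.symm hq i j) k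

lemma metricInner_comm (hG : IsMetricOn G U) (hp : p ∈ U) (X Y : Fin m → ℝ) :
    metricInner G p X Y = metricInner G p Y X := by
  unfold metricInner
  rw [Finset.sum_comm]
  refine Finset.sum_congr rfl fun i _ => Finset.sum_congr rfl fun j _ => ?_
  rw [hG.symm hp i j]
  ring

lemma metricInner_self_pos (hG : IsMetricOn G U) (hp : p ∈ U) {X : Fin m → ℝ} (hX : X ≠ 0) :
    0 < metricInner G p X X := by
  rw [metricInner_eq_toBilin', Matrix.toBilin'_apply']
  simpa using (hG.posDef p hp).dotProduct_mulVec_pos hX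

lemma metricInner_self_nonneg (hG : IsMetricOn G U) (hp : p ∈ U) (X : Fin m → ℝ) :
    0 ≤ metricInner G p X X := by
  rcases eq_or_ne X 0 with rfl | hX
  · simp [metricInner]
  · exact (hG.metricInner_self_pos hp hX).le

lemma metricInner_sq_lt (hG : IsMetricOn G U) (hp : p ∈ U) {X Y : Fin m → ℝ}
    (hXY : LinearIndependent ℝ ![X, Y]) :
    metricInner G p X Y ^ 2 < metricInner G p X X * metricInner G p Y Y := by
  simp only [metricInner_eq_toBilin']
  refine (LinearMap.BilinForm.apply_sq_lt_iff_linearIndependent_of_symm _ (fun Z hZ => ?_)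
    ⟨fun Z W => ?_⟩ X Y).2 hXY
  · simpa only [metricInner_eq_toBilin'] using hG.metricInner_self_pos hp hZ
  · simpa only [metricInner_eq_toBilin', RingHom.id_apply] using hG.metricInner_comm hp Z W

lemma contDiffOn_christoffel (hG : IsMetricOn G U) (k i j : Fin m) :
    ContDiffOn ℝ ∞ (christoffel G k i j) U := by
  have hpd (a b c : Fin m) := contDiffOn_pd hG.isOpen (hG.contDiffOn b c) a
  refine contDiffOn_const.mul (ContDiffOn.sum fun l _ => .mul ?_ ?_)
  · exact contDiffOn_inv hG.contDiffOn (fun q hq => (hG.posDef q hq).det_pos.ne') k l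
  · exact ((hpd i j l).add (hpd j i l)).sub (hpd l i j)

lemma christoffel_symm (hG : IsMetricOn G U) (hp : p ∈ U) (k i j : Fin m) :
    christoffel G k i j p = christoffel G k j i p := by
  unfold christoffel
  congr 1
  refine Finset.sum_congr rfl fun l _ => ?_
  rw [hG.pd_symm hp l i j]
  ring

lemma sum_mul_christoffel (hG : IsMetricOn G U) (hp : p ∈ U) (b i j : Fin m) :
    ∑ k, G p b k * christoffel G k i j p =
      (1 / 2) * (pd i (fun q => G q j b) p + pd j (fun q => G q i b) p -
        pd b (fun q => G q i j) p) := by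
  set first : Fin m → ℝ := fun l =>
    pd i (fun q => G q j l) p + pd j (fun q => G q i l) p - pd l (fun q => G q i j) p
  have raise (k : Fin m) : christoffel G k i j p = (1 / 2) * ((G p)⁻¹ *ᵥ first) k := rfl
  have lower : G p *ᵥ ((G p)⁻¹ *ᵥ first) = first := by
    rw [Matrix.mulVec_mulVec, Matrix.mul_nonsing_inv _
      ((Matrix.isUnit_iff_isUnit_det _).1 (hG.posDef p hp).isUnit), Matrix.one_mulVec]
  simp only [raise, mul_left_comm _ (1 / 2 : ℝ), ← Finset.mul_sum]
  exact congrArg ((1 / 2 : ℝ) * ·) (congrFun lower b)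

lemma pd_eq_sum_christoffel (hG : IsMetricOn G U) (hp : p ∈ U) (k i j : Fin m) :
    pd k (fun q => G q i j) p =
      ∑ l, (christoffel G l k i p * G p l j + G p i l * christoffel G l k j p) := by
  simp only [hG.symm hp _ j, mul_comm (christoffel G _ k i p), Finset.sum_add_distrib,
    hG.sum_mul_christoffel hp, hG.pd_symm hp k j i, hG.pd_symm hp j k i, hG.pd_symm hp i k j]
  ring

end IsMetricOn

/-! ### The connection along a map -/

/-- `u` is a smooth map from the open set `U` of coordinate space to the domain `V` of the
Riemannian metric `H`. -/
structure IsMapOn (H : Coord n → Matrix (Fin n) (Fin n) ℝ) (V : Set (Coord n))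
    (u : Coord m → Coord n) (U : Set (Coord m)) : Prop where
  metric : IsMetricOn H V
  isOpen : IsOpen U
  contDiffOn : ContDiffOn ℝ ∞ u U
  mapsTo : Set.MapsTo u U V

/-- The connection matrix `Aᵢ` of the map `u`, characterised by `∇^u_{∂ᵢ} X = ∂ᵢX + Aᵢ X` for
vector fields `X` along `u`. -/
noncomputable def connectionMatrix (H : Coord n → Matrix (Fin n) (Fin n) ℝ)
    (u : Coord m → Coord n) (i : Fin m) (p : Coord m) : Matrix (Fin n) (Fin n) ℝ :=
  Matrix.of fun α γ => ∑ β, christoffel H α β γ (u p) * push u i p β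

section ConnectionAlong

variable {H : Coord n → Matrix (Fin n) (Fin n) ℝ} {V : Set (Coord n)}
  {u : Coord m → Coord n} {U : Set (Coord m)} {p : Coord m}
  {X Y : Coord m → Fin n → ℝ}

lemma covAlong_apply (i : Fin m) (α : Fin n) :
    covAlong H u i X p α = pd i (fun q => X q α) p + ∑ γ, connectionMatrix H u i p α γ * X p γ := by
  simp only [covAlong, connectionMatrix, Matrix.of_apply, Finset.sum_mul]
  rw [Finset.sum_comm]

lemma connectionMatrix_mul_apply (i j : Fin m) (α γ : Fin n) :
    (connectionMatrix H u i p * connectionMatrix H u j p) α γ =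
      ∑ b, ∑ c, (∑ a, christoffel H α b a (u p) * christoffel H a c γ (u p)) *
        push u i p b * push u j p c := by
  simp only [Matrix.mul_apply, connectionMatrix, Matrix.of_apply, Finset.sum_mul,
    Finset.mul_sum]
  rw [← Finset.sum_comm_cycle]
  refine Finset.sum_comm.trans (Finset.sum_congr rfl fun b _ => Finset.sum_congr rfl fun c _ => ?_)
  exact Finset.sum_congr rfl fun a _ => by ring

lemma differentiableAt_component (hU : IsOpen U) (hX : ContDiffOn ℝ ∞ X U) (hp : p ∈ U)
    (α : Fin n) : DifferentiableAt ℝ (fun q => X q α) p :=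
  differentiableAt_of_contDiffOn hU (contDiffOn_pi.1 hX α) hp

lemma covAlong_congr (hU : IsOpen U) (hp : p ∈ U) (h : Set.EqOn X Y U) (i : Fin m) :
    covAlong H u i X p = covAlong H u i Y p := by
  ext α
  rw [covAlong_apply, covAlong_apply, h hp, pd_congr hU hp fun q hq => congrFun (h hq) α]

namespace IsMapOn

lemma contDiffOn_comp (hu : IsMapOn H V u U) {F : Coord n → ℝ} (hF : ContDiffOn ℝ ∞ F V) :
    ContDiffOn ℝ ∞ (fun q => F (u q)) U :=
  hF.comp hu.contDiffOn hu.mapsTo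

lemma pd_comp (hu : IsMapOn H V u U) {F : Coord n → ℝ} (hF : ContDiffOn ℝ ∞ F V) (hp : p ∈ U)
    (i : Fin m) : pd i (fun q => F (u q)) p = ∑ c, pd c F (u p) * push u i p c :=
  LocalGeom.pd_comp i (differentiableAt_of_contDiffOn hu.metric.isOpen hF (hu.mapsTo hp))
    ((hu.contDiffOn.contDiffAt (hu.isOpen.mem_nhds hp)).differentiableAt (by simp))

lemma contDiffOn_push (hu : IsMapOn H V u U) (i : Fin m) : ContDiffOn ℝ ∞ (push u i) U :=
  contDiffOn_pi.2 fun α => contDiffOn_pd hu.isOpen (contDiffOn_euclidean.1 hu.contDiffOn α) i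

lemma contDiffOn_connectionMatrix (hu : IsMapOn H V u U) (i : Fin m) (α γ : Fin n) :
    ContDiffOn ℝ ∞ (fun q => connectionMatrix H u i q α γ) U := by
  simp only [connectionMatrix, Matrix.of_apply]
  exact ContDiffOn.sum fun β _ => (hu.contDiffOn_comp
    (hu.metric.contDiffOn_christoffel α β γ)).mul (contDiffOn_pi.1 (hu.contDiffOn_push i) β)

lemma contDiffOn_covAlong (hu : IsMapOn H V u U) (hX : ContDiffOn ℝ ∞ X U) (i : Fin m) :
    ContDiffOn ℝ ∞ (covAlong H u i X) U := by
  refine contDiffOn_pi.2 fun α => ?_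
  simp only [covAlong_apply]
  exact (contDiffOn_pd hu.isOpen (contDiffOn_pi.1 hX α) i).add <| ContDiffOn.sum fun γ _ =>
    (hu.contDiffOn_connectionMatrix i α γ).mul (contDiffOn_pi.1 hX γ)

lemma contDiffOn_metricInner (hu : IsMapOn H V u U) (hX : ContDiffOn ℝ ∞ X U)
    (hY : ContDiffOn ℝ ∞ Y U) : ContDiffOn ℝ ∞ (fun q => metricInner H (u q) (X q) (Y q)) U :=
  ContDiffOn.sum fun i _ => ContDiffOn.sum fun j _ =>
    ((hu.contDiffOn_comp (hu.metric.contDiffOn i j)).mul (contDiffOn_pi.1 hX i)).mul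
      (contDiffOn_pi.1 hY j)

lemma pd_metric (hu : IsMapOn H V u U) (hp : p ∈ U) (i : Fin m) (a b : Fin n) :
    pd i (fun q => H (u q) a b) p =
      ∑ c, (connectionMatrix H u i p c a * H (u p) c b +
        H (u p) a c * connectionMatrix H u i p c b) := by
  rw [hu.pd_comp (hu.metric.contDiffOn a b) hp]
  simp only [hu.metric.pd_eq_sum_christoffel (hu.mapsTo hp), connectionMatrix, Matrix.of_apply,
    Finset.sum_mul, Finset.mul_sum, ← Finset.sum_add_distrib]
  rw [Finset.sum_comm]
  exact Finset.sum_congr rfl fun c _ => Finset.sum_congr rfl fun β _ => by ring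

lemma pd_metricInner (hu : IsMapOn H V u U) (hX : ContDiffOn ℝ ∞ X U) (hY : ContDiffOn ℝ ∞ Y U)
    (hp : p ∈ U) (i : Fin m) :
    pd i (fun q => metricInner H (u q) (X q) (Y q)) p =
      metricInner H (u p) (covAlong H u i X p) (Y p) +
        metricInner H (u p) (X p) (covAlong H u i Y p) := by
  have dX := differentiableAt_component hu.isOpen hX hp
  have dY := differentiableAt_component hu.isOpen hY hp
  have dH (a b : Fin n) : DifferentiableAt ℝ (fun q => H (u q) a b) p :=
    differentiableAt_of_contDiffOn hu.isOpen (hu.contDiffOn_comp (hu.metric.contDiffOn a b)) hp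
  have leibniz : pd i (fun q => metricInner H (u q) (X q) (Y q)) p =
      ∑ a, ∑ b, (pd i (fun q => H (u q) a b) p * X p a * Y p b +
        H (u p) a b * pd i (fun q => X q a) p * Y p b +
        H (u p) a b * X p a * pd i (fun q => Y q b) p) := by
    unfold metricInner
    rw [pd_sum _ _ fun a _ => .fun_sum fun b _ => ((dH a b).fun_mul (dX a)).fun_mul (dY b)]
    refine Finset.sum_congr rfl fun a _ => ?_
    rw [pd_sum _ _ fun b _ => ((dH a b).fun_mul (dX a)).fun_mul (dY b)]
    refine Finset.sum_congr rfl fun b _ => ?_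
    rw [pd_mul _ ((dH a b).fun_mul (dX a)) (dY b), pd_mul _ (dH a b) (dX a)]
    ring
  have connection_left : ∑ a, ∑ b, H (u p) a b * (∑ c, connectionMatrix H u i p a c * X p c) *
      Y p b = ∑ a, ∑ b, (∑ c, connectionMatrix H u i p c a * H (u p) c b) * X p a * Y p b := by
    simp only [Finset.mul_sum, Finset.sum_mul]
    rw [Finset.sum_comm_cycle]
    refine Finset.sum_congr rfl fun a _ => Finset.sum_comm.trans ?_
    exact Finset.sum_congr rfl fun b _ => Finset.sum_congr rfl fun c _ => by ring
  have connection_right : ∑ a, ∑ b, H (u p) a b * X p a *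
      (∑ c, connectionMatrix H u i p b c * Y p c) =
      ∑ a, ∑ b, (∑ c, H (u p) a c * connectionMatrix H u i p c b) * X p a * Y p b := by
    simp only [Finset.mul_sum, Finset.sum_mul]
    refine Finset.sum_congr rfl fun a _ => Finset.sum_comm.trans ?_
    exact Finset.sum_congr rfl fun b _ => Finset.sum_congr rfl fun c _ => by ring
  rw [leibniz]
  simp only [metricInner, covAlong_apply, hu.pd_metric hp, mul_add, add_mul, Finset.sum_add_distrib,
    connection_left, connection_right]
  ring

lemma covAlong_push_comm (hu : IsMapOn H V u U) (hp : p ∈ U) (i j : Fin m) :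
    covAlong H u i (push u j) p = covAlong H u j (push u i) p := by
  ext α
  have hα := ((contDiffOn_euclidean.1 hu.contDiffOn α).contDiffAt (hu.isOpen.mem_nhds hp)).of_le
    (m := 2) (by norm_cast)
  refine congrArg₂ (· + ·) (pd_comm hα i j) (Finset.sum_comm.trans ?_)
  refine Finset.sum_congr rfl fun β _ => Finset.sum_congr rfl fun γ _ => ?_
  rw [hu.metric.christoffel_symm (hu.mapsTo hp)]
  ring

/-! ### Curvature as the commutator of covariant derivatives -/

lemma pd_connectionMatrix (hu : IsMapOn H V u U) (hp : p ∈ U) (i j : Fin m) (α γ : Fin n) :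
    pd i (fun q => connectionMatrix H u j q α γ) p =
      ∑ b, ∑ c, pd b (christoffel H α c γ) (u p) * push u i p b * push u j p c +
        ∑ c, christoffel H α c γ (u p) * pd i (fun q => push u j q c) p := by
  have dΓ (c : Fin n) : DifferentiableAt ℝ (fun q => christoffel H α c γ (u q)) p :=
    differentiableAt_of_contDiffOn hu.isOpen
      (hu.contDiffOn_comp (hu.metric.contDiffOn_christoffel α c γ)) hp
  have du := differentiableAt_component hu.isOpen (hu.contDiffOn_push j) hp
  simp only [connectionMatrix, Matrix.of_apply]
  rw [pd_sum _ _ fun c _ => (dΓ c).fun_mul (du c)]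
  simp only [pd_mul i (dΓ _) (du _), hu.pd_comp (hu.metric.contDiffOn_christoffel α _ γ) hp,
    Finset.sum_mul, Finset.sum_add_distrib]
  rw [Finset.sum_comm]

lemma pd_connectionMatrix_sub_add_commutator (hu : IsMapOn H V u U) (hp : p ∈ U) (i j : Fin m)
    (α γ : Fin n) :
    pd i (fun q => connectionMatrix H u j q α γ) p -
        pd j (fun q => connectionMatrix H u i q α γ) p +
        ((connectionMatrix H u i p * connectionMatrix H u j p) α γ -
          (connectionMatrix H u j p * connectionMatrix H u i p) α γ) =
      ∑ b, ∑ c, curvatureComponent H α γ b c (u p) * push u i p b * push u j p c := by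
  have second_derivatives_comm (c : Fin n) :
      pd i (fun q => push u j q c) p = pd j (fun q => push u i q c) p :=
    pd_comm (((contDiffOn_euclidean.1 hu.contDiffOn c).contDiffAt (hu.isOpen.mem_nhds hp)).of_le
      (by norm_cast)) i j
  rw [hu.pd_connectionMatrix hp i j, hu.pd_connectionMatrix hp j i, connectionMatrix_mul_apply,
    connectionMatrix_mul_apply, Finset.sum_comm (f := fun b c => _ * push u j p b * push u i p c),
    Finset.sum_comm (f := fun b c => _ * push u j p b * push u i p c)]
  simp only [second_derivatives_comm, add_sub_add_right_eq_sub, ← Finset.sum_sub_distrib,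
    ← Finset.sum_add_distrib, curvatureComponent, mul_right_comm _ (push u j p _)]
  simp only [← sub_mul, ← add_mul, Finset.sum_sub_distrib]

lemma covAlong_covAlong (hu : IsMapOn H V u U) (hX : ContDiffOn ℝ ∞ X U) (hp : p ∈ U)
    (i j : Fin m) (α : Fin n) :
    covAlong H u i (covAlong H u j X) p α =
      pd i (pd j fun q => X q α) p +
        (∑ γ, connectionMatrix H u j p α γ * pd i (fun q => X q γ) p +
          ∑ γ, connectionMatrix H u i p α γ * pd j (fun q => X q γ) p) +
        ∑ γ, (pd i (fun q => connectionMatrix H u j q α γ) p +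
          (connectionMatrix H u i p * connectionMatrix H u j p) α γ) * X p γ := by
  have dX := differentiableAt_component hu.isOpen hX hp
  have dA (γ : Fin n) : DifferentiableAt ℝ (fun q => connectionMatrix H u j q α γ) p :=
    differentiableAt_of_contDiffOn hu.isOpen (hu.contDiffOn_connectionMatrix j α γ) hp
  have dpd : DifferentiableAt ℝ (pd j fun q => X q α) p :=
    differentiableAt_of_contDiffOn hu.isOpen
      (contDiffOn_pd hu.isOpen (contDiffOn_pi.1 hX α) j) hp
  have product : ∑ a, connectionMatrix H u i p α a * ∑ γ, connectionMatrix H u j p a γ * X p γ =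
      ∑ γ, (connectionMatrix H u i p * connectionMatrix H u j p) α γ * X p γ :=
    congrFun (Matrix.mulVec_mulVec (X p) (connectionMatrix H u i p) (connectionMatrix H u j p)) α
  simp only [covAlong_apply, mul_add, Finset.sum_add_distrib, product]
  rw [pd_add i dpd (.fun_sum fun γ _ => (dA γ).fun_mul (dX γ)),
    pd_sum _ _ fun γ _ => (dA γ).fun_mul (dX γ)]
  simp only [pd_mul i (dA _) (dX _), add_mul, Finset.sum_add_distrib]
  ring

lemma covAlong_commutator (hu : IsMapOn H V u U) (hX : ContDiffOn ℝ ∞ X U) (hp : p ∈ U)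
    (i j : Fin m) :
    covAlong H u i (covAlong H u j X) p - covAlong H u j (covAlong H u i X) p =
      curvatureOperator H (u p) (push u i p) (push u j p) (X p) := by
  ext α
  have hα := ((contDiffOn_pi.1 hX α).contDiffAt (hu.isOpen.mem_nhds hp)).of_le
    (m := 2) (by norm_cast)
  simp only [Pi.sub_apply, curvatureOperator, ← Finset.sum_mul,
    ← hu.pd_connectionMatrix_sub_add_commutator hp, hu.covAlong_covAlong hX hp,
    pd_comm hα i j, add_mul, sub_mul, Finset.sum_add_distrib, Finset.sum_sub_distrib]
  ring

end IsMapOn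

end ConnectionAlong

/-! ### Symmetries of the curvature tensor -/

section CurvatureSymmetries

variable {H : Coord n → Matrix (Fin n) (Fin n) ℝ} {V : Set (Coord n)} {p : Coord n}

lemma curvatureComponent_swap (l k i j : Fin n) :
    curvatureComponent H l k i j p = -curvatureComponent H l k j i p := by
  simp only [curvatureComponent, Finset.sum_sub_distrib]
  ring

lemma curvatureOperator_swap (X Y Z : Fin n → ℝ) :
    curvatureOperator H p X Y Z = -curvatureOperator H p Y X Z := by
  ext l
  simp only [curvatureOperator, Pi.neg_apply, ← Finset.sum_neg_distrib]
  refine Finset.sum_congr rfl fun k _ => Finset.sum_comm.trans ?_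
  refine Finset.sum_congr rfl fun i _ => Finset.sum_congr rfl fun j _ => ?_
  rw [curvatureComponent_swap]
  ring

lemma curvatureOperator_add_left (X X' Y Z : Fin n → ℝ) :
    curvatureOperator H p (X + X') Y Z =
      curvatureOperator H p X Y Z + curvatureOperator H p X' Y Z := by
  ext l
  simp only [curvatureOperator, Pi.add_apply, mul_add, add_mul, Finset.sum_add_distrib]

lemma curvatureOperator_smul_left (c : ℝ) (X Y Z : Fin n → ℝ) :
    curvatureOperator H p (c • X) Y Z = c • curvatureOperator H p X Y Z := by
  ext l
  simp only [curvatureOperator, Pi.smul_apply, smul_eq_mul, Finset.mul_sum, mul_left_comm _ c,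
    mul_assoc]

lemma curvatureOperator_add_right (X Y Z Z' : Fin n → ℝ) :
    curvatureOperator H p X Y (Z + Z') =
      curvatureOperator H p X Y Z + curvatureOperator H p X Y Z' := by
  ext l
  simp only [curvatureOperator, Pi.add_apply, mul_add, Finset.sum_add_distrib]

lemma curvatureOperator_smul_right (c : ℝ) (X Y Z : Fin n → ℝ) :
    curvatureOperator H p X Y (c • Z) = c • curvatureOperator H p X Y Z := by
  ext l
  simp only [curvatureOperator, Pi.smul_apply, smul_eq_mul, Finset.mul_sum, mul_left_comm _ c]

namespace IsMapOn

variable {u : Coord m → Coord n} {U : Set (Coord m)} {q : Coord m} {X Y : Coord m → Fin n → ℝ}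

lemma pd_pd_metricInner (hu : IsMapOn H V u U) (hX : ContDiffOn ℝ ∞ X U)
    (hY : ContDiffOn ℝ ∞ Y U) (hq : q ∈ U) (i j : Fin m) :
    pd i (pd j fun q => metricInner H (u q) (X q) (Y q)) q =
      metricInner H (u q) (covAlong H u i (covAlong H u j X) q) (Y q) +
        metricInner H (u q) (covAlong H u j X q) (covAlong H u i Y q) +
        (metricInner H (u q) (covAlong H u i X q) (covAlong H u j Y q) +
          metricInner H (u q) (X q) (covAlong H u i (covAlong H u j Y) q)) := by
  have hjX := hu.contDiffOn_covAlong hX j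
  have hjY := hu.contDiffOn_covAlong hY j
  rw [pd_congr hu.isOpen hq fun r hr => hu.pd_metricInner hX hY hr j,
    pd_add i (differentiableAt_of_contDiffOn hu.isOpen (hu.contDiffOn_metricInner hjX hY) hq)
      (differentiableAt_of_contDiffOn hu.isOpen (hu.contDiffOn_metricInner hX hjY) hq),
    hu.pd_metricInner hjX hY hq, hu.pd_metricInner hX hjY hq]

/-- Second derivatives of `⟨X, Y⟩` commute, so the commutator of covariant derivatives is
skew-adjoint. -/
lemma metricInner_curvatureOperator_push_skew (hu : IsMapOn H V u U) (hX : ContDiffOn ℝ ∞ X U)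
    (hY : ContDiffOn ℝ ∞ Y U) (hq : q ∈ U) (i j : Fin m) :
    metricInner H (u q) (curvatureOperator H (u q) (push u i q) (push u j q) (X q)) (Y q) =
      -metricInner H (u q) (curvatureOperator H (u q) (push u i q) (push u j q) (Y q)) (X q) := by
  have hsmooth := ((hu.contDiffOn_metricInner hX hY).contDiffAt (hu.isOpen.mem_nhds hq)).of_le
    (m := 2) (by norm_cast)
  have hcomm := pd_comm hsmooth i j
  rw [hu.pd_pd_metricInner hX hY hq, hu.pd_pd_metricInner hX hY hq] at hcomm
  rw [← hu.covAlong_commutator hX hq, ← hu.covAlong_commutator hY hq, metricInner_sub_left,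
    metricInner_sub_left]
  have symm := hu.metric.metricInner_comm (hu.mapsTo hq) (X q)
  rw [symm, symm] at hcomm
  linarith

end IsMapOn

/-- The affine map through `p` in the directions `Z i`. It realises any given vectors at `p` as
coordinate vector fields along a map, which turns identities for the curvature along maps into
identities for the curvature tensor. -/
def affineMapThrough {k : ℕ} (p : Coord n) (Z : Fin k → Fin n → ℝ) (x : Coord k) : Coord n :=
  WithLp.toLp 2 fun α => p α + ∑ i, x i * Z i α

lemma affineMapThrough_zero {k : ℕ} (Z : Fin k → Fin n → ℝ) : affineMapThrough p Z 0 = p := by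
  ext α
  simp [affineMapThrough]

lemma contDiff_affineMapThrough {k : ℕ} (Z : Fin k → Fin n → ℝ) :
    ContDiff ℝ ∞ (affineMapThrough p Z) := by
  refine contDiff_euclidean.2 fun α => ?_
  simp only [affineMapThrough]
  fun_prop

lemma pd_coord {k : ℕ} (i j : Fin k) (q : Coord k) :
    pd i (fun x => x j) q = if j = i then 1 else 0 := by
  have hproj := (EuclideanSpace.proj j : Coord k →L[ℝ] ℝ).fderiv (x := q)
  exact (DFunLike.congr_fun hproj _).trans (by simp)

lemma push_affineMapThrough {k : ℕ} (Z : Fin k → Fin n → ℝ) (i : Fin k) (q : Coord k) :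
    push (affineMapThrough p Z) i q = Z i := by
  ext α
  have hcoord (j : Fin k) : DifferentiableAt ℝ (fun x : Coord k => x j) q := by fun_prop
  have hterm (j : Fin k) := (hcoord j).fun_mul (differentiableAt_const (Z j α))
  change pd i (fun x : Coord k => p α + ∑ j, x j * Z j α) q = Z i α
  rw [pd_add _ (differentiableAt_const _) (.fun_sum fun j _ => hterm j),
    pd_const, pd_sum _ _ fun j _ => hterm j]
  simp [pd_mul i (hcoord _) (differentiableAt_const _), pd_coord, pd_const]

namespace IsMetricOn

lemma isMapOn_affineMapThrough {k : ℕ} (hH : IsMetricOn H V) (Z : Fin k → Fin n → ℝ) :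
    IsMapOn H V (affineMapThrough p Z) (affineMapThrough p Z ⁻¹' V) where
  metric := hH
  isOpen := hH.isOpen.preimage (contDiff_affineMapThrough Z).continuous
  contDiffOn := (contDiff_affineMapThrough Z).contDiffOn
  mapsTo := Set.mapsTo_preimage _ _

lemma metricInner_curvatureOperator_skew (hH : IsMetricOn H V) (hp : p ∈ V)
    (X Y Z W : Fin n → ℝ) :
    metricInner H p (curvatureOperator H p X Y Z) W =
      -metricInner H p (curvatureOperator H p X Y W) Z := by
  have h0 : (0 : Coord 2) ∈ affineMapThrough p ![X, Y] ⁻¹' V := by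
    rwa [Set.mem_preimage, affineMapThrough_zero]
  have skew := (hH.isMapOn_affineMapThrough ![X, Y]).metricInner_curvatureOperator_push_skew
    (contDiffOn_const (c := Z)) (contDiffOn_const (c := W)) h0 0 1
  simpa only [affineMapThrough_zero, push_affineMapThrough, Matrix.cons_val] using skew

lemma curvatureOperator_add_cyclic (hH : IsMetricOn H V) (hp : p ∈ V) (X Y Z : Fin n → ℝ) :
    curvatureOperator H p X Y Z + curvatureOperator H p Y Z X + curvatureOperator H p Z X Y =
      0 := by
  set u := affineMapThrough p ![X, Y, Z]
  have hu : IsMapOn H V u (u ⁻¹' V) := hH.isMapOn_affineMapThrough _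
  have h0 : (0 : Coord 3) ∈ u ⁻¹' V := by
    rwa [Set.mem_preimage, show u 0 = p from affineMapThrough_zero _]
  have commutator (i j k : Fin 3) := hu.covAlong_commutator (hu.contDiffOn_push k) h0 i j
  have torsion_free (i j k : Fin 3) : covAlong H u i (covAlong H u j (push u k)) 0 =
      covAlong H u i (covAlong H u k (push u j)) 0 :=
    covAlong_congr hu.isOpen h0 (fun q hq => hu.covAlong_push_comm hq j k) i
  simp only [u, affineMapThrough_zero, push_affineMapThrough] at commutator
  have hXY := commutator 0 1 2
  have hYZ := commutator 1 2 0
  have hZX := commutator 2 0 1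
  simp only [Matrix.cons_val] at hXY hYZ hZX
  rw [← hXY, ← hYZ, ← hZX, torsion_free 0 1 2, torsion_free 1 2 0, torsion_free 2 0 1]
  abel

/-- The four instances of the Bianchi identity are the faces of Milnor's octahedron. -/
lemma metricInner_curvatureOperator_pair_symm (hH : IsMetricOn H V) (hp : p ∈ V)
    (X Y Z W : Fin n → ℝ) :
    metricInner H p (curvatureOperator H p X Y Z) W =
      metricInner H p (curvatureOperator H p Z W X) Y := by
  have skew := hH.metricInner_curvatureOperator_skew hp
  have swap (X Y Z W : Fin n → ℝ) : metricInner H p (curvatureOperator H p X Y Z) W =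
      -metricInner H p (curvatureOperator H p Y X Z) W := by
    rw [curvatureOperator_swap, metricInner_neg_left]
  have bianchi (X Y Z W : Fin n → ℝ) : metricInner H p (curvatureOperator H p X Y Z) W +
      metricInner H p (curvatureOperator H p Y Z X) W +
      metricInner H p (curvatureOperator H p Z X Y) W = 0 := by
    rw [← metricInner_add_left, ← metricInner_add_left, hH.curvatureOperator_add_cyclic hp]
    simp [metricInner]
  linarith [bianchi X Y Z W, bianchi Y Z W X, bianchi Z W X Y, bianchi W X Y Z, skew X Y Z W,
    skew Y Z X W, skew Z W X Y, skew W X Y Z, skew Z X Y W, swap X Z W Y, skew W Y X Z,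
    swap Y W X Z]

end IsMetricOn

/-! ### Nonpositive curvature -/

/-- The metric `H` has nonpositive sectional curvature on `V`. -/
def NonpositivelyCurvedOn (H : Coord n → Matrix (Fin n) (Fin n) ℝ) (V : Set (Coord n)) : Prop :=
  ∀ p ∈ V, ∀ X Y : Fin n → ℝ, LinearIndependent ℝ ![X, Y] → sectionalCurvature H p X Y ≤ 0

lemma NonpositivelyCurvedOn.metricInner_curvatureOperator_nonpos (hH : IsMetricOn H V)
    (hsec : NonpositivelyCurvedOn H V) (hp : p ∈ V) (X Y : Fin n → ℝ) :
    metricInner H p (curvatureOperator H p X Y Y) X ≤ 0 := by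
  by_cases hXY : LinearIndependent ℝ ![X, Y]
  · have gram_pos : 0 < metricInner H p X X * metricInner H p Y Y - metricInner H p X Y ^ 2 :=
      sub_pos.2 (hH.metricInner_sq_lt hp hXY)
    simpa only [zero_mul] using (div_le_iff₀ gram_pos).1 (hsec p hp X Y hXY)
  rcases eq_or_ne X 0 with rfl | hX
  · simp [metricInner]
  obtain ⟨a, rfl⟩ : ∃ a : ℝ, a • X = Y := by
    simpa only [LinearIndependent.pair_iff' hX, not_forall, not_not] using hXY
  have skew := hH.metricInner_curvatureOperator_skew hp X (a • X) X X
  rw [curvatureOperator_smul_right, metricInner_smul_left, self_eq_neg.1 skew, mul_zero]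

lemma NonpositivelyCurvedOn.metricTrace_curvatureOperator_nonneg {ι : Type*} [Fintype ι]
    [DecidableEq ι] {g : Matrix ι ι ℝ} (hg : g.PosDef) (hH : IsMetricOn H V)
    (hsec : NonpositivelyCurvedOn H V) (hp : p ∈ V) (w : Fin n → ℝ) (X : ι → Fin n → ℝ) :
    0 ≤ metricTrace g fun i j => metricInner H p (curvatureOperator H p (X i) w (X j)) w := by
  refine metricTrace_nonneg hg (LinearMap.mk₂ ℝ
    (fun X Y => metricInner H p (curvatureOperator H p X w Y) w) ?_ ?_ ?_ ?_) (fun X => ?_) X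
  · simp only [curvatureOperator_add_left, metricInner_add_left, implies_true]
  · simp only [curvatureOperator_smul_left, metricInner_smul_left, smul_eq_mul, implies_true]
  · simp only [curvatureOperator_add_right, metricInner_add_left, implies_true]
  · simp only [curvatureOperator_smul_right, metricInner_smul_left, smul_eq_mul, implies_true]
  · rw [LinearMap.mk₂_apply, hH.metricInner_curvatureOperator_skew hp]
    exact neg_nonneg.2 (hsec.metricInner_curvatureOperator_nonpos hH hp X w)

end CurvatureSymmetries

/-! ### The Jacobi operator -/

/-- The second covariant derivative `∇²w(∂ᵢ, ∂ⱼ) = ∇^u_{∂ᵢ}∇^u_{∂ⱼ} w - ∇^u_{∇_{∂ᵢ}∂ⱼ} w` of a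
vector field `w` along `u`. -/
noncomputable def hessianAlong (G : Coord m → Matrix (Fin m) (Fin m) ℝ)
    (H : Coord n → Matrix (Fin n) (Fin n) ℝ) (u : Coord m → Coord n) (w : Coord m → Fin n → ℝ)
    (i j : Fin m) (p : Coord m) : Fin n → ℝ :=
  covAlong H u i (covAlong H u j w) p - ∑ k, christoffel G k i j p • covAlong H u k w p

/-- The Jacobi operator `w ↦ Trace_g ∇²w - Trace_g R(du, w)du` of the map `u`, whose value on the
tension field is the bitension field. -/
noncomputable def jacobiOperator (G : Coord m → Matrix (Fin m) (Fin m) ℝ)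
    (H : Coord n → Matrix (Fin n) (Fin n) ℝ) (u : Coord m → Coord n) (w : Coord m → Fin n → ℝ)
    (p : Coord m) : Fin n → ℝ :=
  (metricTrace (G p) fun i j => hessianAlong G H u w i j p) -
    metricTrace (G p) fun i j => curvatureOperator H (u p) (push u i p) (w p) (push u j p)

/-- The mean curvature vector `η = (1/m) Trace_g ∇du` of an immersion `u` of an `m`-dimensional
manifold. -/
noncomputable def meanCurvature (G : Coord m → Matrix (Fin m) (Fin m) ℝ)
    (H : Coord n → Matrix (Fin n) (Fin n) ℝ) (u : Coord m → Coord n) (p : Coord m) : Fin n → ℝ :=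
  (1 / (m : ℝ)) • tension G H u p

section

variable {G : Coord m → Matrix (Fin m) (Fin m) ℝ} {H : Coord n → Matrix (Fin n) (Fin n) ℝ}
  {V : Set (Coord n)} {u : Coord m → Coord n} {U : Set (Coord m)} {p : Coord m}
  {w : Coord m → Fin n → ℝ}

lemma secondForm_eq_covAlong_sub (i j : Fin m) :
    secondForm G H u i j p =
      covAlong H u i (push u j) p - ∑ k, christoffel G k i j p • push u k p := by
  ext α
  simp only [secondForm, Pi.sub_apply, Finset.sum_apply, Pi.smul_apply, smul_eq_mul]

lemma tension_eq_metricTrace :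
    tension G H u p = metricTrace (G p) fun i j => secondForm G H u i j p := by
  ext α
  rw [metricTrace_apply]
  rfl

lemma bitension_eq_jacobiOperator_tension :
    bitension G H u p = jacobiOperator G H u (tension G H u) p := by
  ext α
  simp only [jacobiOperator, Pi.sub_apply, metricTrace_apply, hessianAlong, Finset.sum_apply,
    Pi.smul_apply]
  rfl

lemma metricInner_jacobiOperator (Z : Fin n → ℝ) :
    metricInner H (u p) (jacobiOperator G H u w p) Z =
      (metricTrace (G p) fun i j => metricInner H (u p) (hessianAlong G H u w i j p) Z) -
        metricTrace (G p) fun i j => metricInner H (u p)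
          (curvatureOperator H (u p) (push u i p) (w p) (push u j p)) Z := by
  rw [jacobiOperator, metricInner_sub_left, metricInner_metricTrace, metricInner_metricTrace]

namespace IsMapOn

lemma metricInner_comm (hu : IsMapOn H V u U) (hp : p ∈ U) (X Y : Fin n → ℝ) :
    metricInner H (u p) X Y = metricInner H (u p) Y X :=
  hu.metric.metricInner_comm (hu.mapsTo hp) X Y

lemma contDiffOn_tension (hu : IsMapOn H V u U) (hG : IsMetricOn G U) :
    ContDiffOn ℝ ∞ (tension G H u) U := by
  refine contDiffOn_pi.2 fun α => ContDiffOn.sum fun i _ => ContDiffOn.sum fun j _ => .mul ?_ ?_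
  · exact contDiffOn_inv hG.contDiffOn (fun q hq => (hG.posDef q hq).det_pos.ne') i j
  · exact (contDiffOn_pi.1 (hu.contDiffOn_covAlong (hu.contDiffOn_push j) i) α).sub <|
      ContDiffOn.sum fun k _ =>
        (hG.contDiffOn_christoffel k i j).mul (contDiffOn_pi.1 (hu.contDiffOn_push k) α)

lemma contDiffOn_meanCurvature (hu : IsMapOn H V u U) (hG : IsMetricOn G U) :
    ContDiffOn ℝ ∞ (meanCurvature G H u) U :=
  (hu.contDiffOn_tension hG).const_smul _

lemma hessianAlong_sub_hessianAlong (hu : IsMapOn H V u U) (hG : IsMetricOn G U)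
    (hw : ContDiffOn ℝ ∞ w U) (hp : p ∈ U) (i j : Fin m) :
    hessianAlong G H u w i j p - hessianAlong G H u w j i p =
      curvatureOperator H (u p) (push u i p) (push u j p) (w p) := by
  simp only [hessianAlong, hG.christoffel_symm hp _ j i, sub_sub_sub_cancel_right,
    hu.covAlong_commutator hw hp]

lemma metricInner_hessianAlong_self (hu : IsMapOn H V u U) (hw : ContDiffOn ℝ ∞ w U)
    (hconst : ∀ q ∈ U, ∀ k, metricInner H (u q) (covAlong H u k w q) (w q) = 0) (hp : p ∈ U)
    (i j : Fin m) :
    metricInner H (u p) (hessianAlong G H u w i j p) (w p) =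
      -metricInner H (u p) (covAlong H u i w p) (covAlong H u j w p) := by
  have derivative := hu.pd_metricInner (hu.contDiffOn_covAlong hw j) hw hp i
  rw [pd_congr hu.isOpen hp (fun q hq => hconst q hq j), pd_const,
    hu.metricInner_comm hp (covAlong H u j w p)] at derivative
  simp only [hessianAlong, metricInner_sub_left, metricInner_sum_left, metricInner_smul_left,
    hconst p hp, mul_zero, Finset.sum_const_zero]
  linarith

end IsMapOn

end

/-! ### Isometric immersions -/

/-- `u` is an isometric immersion of the metric `G` on `U` into the metric `H` on `V`. -/
structure IsIsometricOn (G : Coord m → Matrix (Fin m) (Fin m) ℝ)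
    (H : Coord n → Matrix (Fin n) (Fin n) ℝ) (V : Set (Coord n)) (u : Coord m → Coord n)
    (U : Set (Coord m)) : Prop extends IsMapOn H V u U where
  metricSource : IsMetricOn G U
  isometric : ∀ q ∈ U, ∀ j k, G q j k = metricInner H (u q) (push u j q) (push u k q)

/-- The vector field `w` along `u` is normal to the image of `du` at the points of `U`. -/
def IsNormalOn (H : Coord n → Matrix (Fin n) (Fin n) ℝ) (u : Coord m → Coord n)
    (w : Coord m → Fin n → ℝ) (U : Set (Coord m)) : Prop :=
  ∀ q ∈ U, ∀ k, metricInner H (u q) (w q) (push u k q) = 0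

namespace IsIsometricOn

variable {G : Coord m → Matrix (Fin m) (Fin m) ℝ} {H : Coord n → Matrix (Fin n) (Fin n) ℝ}
  {V : Set (Coord n)} {u : Coord m → Coord n} {U : Set (Coord m)} {p : Coord m}
  {w : Coord m → Fin n → ℝ}

/-- The Koszul formula: both sides are the same combination of the derivatives of `G`. -/
lemma metricInner_covAlong_push_push (hu : IsIsometricOn G H V u U) (hp : p ∈ U)
    (i j k : Fin m) :
    metricInner H (u p) (covAlong H u i (push u j) p) (push u k p) =
      ∑ l, G p k l * christoffel G l i j p := by
  have derivative (a b c : Fin m) : pd a (fun q => G q b c) p =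
      metricInner H (u p) (covAlong H u a (push u b) p) (push u c p) +
        metricInner H (u p) (covAlong H u a (push u c) p) (push u b p) := by
    rw [pd_congr hu.isOpen hp fun q hq => hu.isometric q hq b c,
      hu.pd_metricInner (hu.contDiffOn_push b) (hu.contDiffOn_push c) hp,
      hu.metricInner_comm hp (push u b p)]
  have torsion_free := hu.covAlong_push_comm hp
  rw [hu.metricSource.sum_mul_christoffel hp, derivative, derivative, derivative,
    torsion_free j i, torsion_free k i, torsion_free k j]
  ring

lemma metricInner_secondForm_push (hu : IsIsometricOn G H V u U) (hp : p ∈ U) (i j k : Fin m) :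
    metricInner H (u p) (secondForm G H u i j p) (push u k p) = 0 := by
  simp only [secondForm_eq_covAlong_sub, metricInner_sub_left, metricInner_sum_left,
    metricInner_smul_left, hu.metricInner_covAlong_push_push hp, ← hu.isometric p hp,
    hu.metricSource.symm hp k, mul_comm (christoffel G _ i j p), sub_self]

lemma isNormalOn_tension (hu : IsIsometricOn G H V u U) : IsNormalOn H u (tension G H u) U := by
  intro q hq k
  rw [tension_eq_metricTrace, metricInner_metricTrace]
  simp [hu.metricInner_secondForm_push hq, metricTrace]

lemma metricInner_covAlong_normal_push (hu : IsIsometricOn G H V u U)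
    (hw : ContDiffOn ℝ ∞ w U) (hnormal : IsNormalOn H u w U) (hp : p ∈ U) (i k : Fin m) :
    metricInner H (u p) (covAlong H u i w p) (push u k p) =
      -metricInner H (u p) (w p) (secondForm G H u i k p) := by
  have derivative := hu.pd_metricInner hw (hu.contDiffOn_push k) hp i
  rw [pd_congr hu.isOpen hp (fun q hq => hnormal q hq k), pd_const] at derivative
  simp only [secondForm_eq_covAlong_sub, metricInner_sub_right, metricInner_sum_right,
    metricInner_smul_right, hnormal p hp, mul_zero, Finset.sum_const_zero]
  linarith

end IsIsometricOn

/-! ### Umbilical immersions -/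

/-- `u` is a totally umbilical isometric immersion of `G` on `U` into `H` on `V`. -/
structure IsUmbilicOn (G : Coord m → Matrix (Fin m) (Fin m) ℝ)
    (H : Coord n → Matrix (Fin n) (Fin n) ℝ) (V : Set (Coord n)) (u : Coord m → Coord n)
    (U : Set (Coord m)) : Prop extends IsIsometricOn G H V u U where
  umbilic : ∀ q ∈ U, ∀ i j, secondForm G H u i j q = G q i j • meanCurvature G H u q

/-- The principal curvature `⟨w, η⟩` of an umbilical immersion in the direction of a normal
field `w`, normalised so that the shape operator is `X ↦ ⟨w, η⟩ X` also for `w` not of unit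
length. -/
noncomputable def principalCurvature (G : Coord m → Matrix (Fin m) (Fin m) ℝ)
    (H : Coord n → Matrix (Fin n) (Fin n) ℝ) (u : Coord m → Coord n) (w : Coord m → Fin n → ℝ)
    (q : Coord m) : ℝ :=
  metricInner H (u q) (w q) (meanCurvature G H u q)

namespace IsUmbilicOn

variable {G : Coord m → Matrix (Fin m) (Fin m) ℝ} {H : Coord n → Matrix (Fin n) (Fin n) ℝ}
  {V : Set (Coord n)} {u : Coord m → Coord n} {U : Set (Coord m)} {p : Coord m}
  {w : Coord m → Fin n → ℝ}

lemma metricInner_covAlong_normal_push (hu : IsUmbilicOn G H V u U) (hw : ContDiffOn ℝ ∞ w U)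
    (hnormal : IsNormalOn H u w U) (hp : p ∈ U) (i k : Fin m) :
    metricInner H (u p) (covAlong H u i w p) (push u k p) =
      -(G p i k * principalCurvature G H u w p) := by
  rw [hu.toIsIsometricOn.metricInner_covAlong_normal_push hw hnormal hp, hu.umbilic p hp,
    metricInner_smul_right, principalCurvature]

lemma metricInner_covAlong_push (hu : IsUmbilicOn G H V u U) (hp : p ∈ U) (i k : Fin m)
    (X : Fin n → ℝ) :
    metricInner H (u p) X (covAlong H u i (push u k) p) =
      G p i k * metricInner H (u p) X (meanCurvature G H u p) +
        ∑ l, christoffel G l i k p * metricInner H (u p) X (push u l p) := by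
  rw [← sub_add_cancel (covAlong H u i (push u k) p) (∑ l, christoffel G l i k p • push u l p),
    ← secondForm_eq_covAlong_sub, hu.umbilic p hp]
  simp only [metricInner_add_right, metricInner_smul_right, metricInner_sum_right]

lemma metricInner_hessianAlong_push (hu : IsUmbilicOn G H V u U) (hw : ContDiffOn ℝ ∞ w U)
    (hnormal : IsNormalOn H u w U) (hp : p ∈ U) (i j k : Fin m) :
    metricInner H (u p) (hessianAlong G H u w i j p) (push u k p) =
      -(G p j k * pd i (principalCurvature G H u w) p) -
        G p i k * metricInner H (u p) (covAlong H u j w p) (meanCurvature G H u p) := by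
  have weingarten {q : Coord m} (hq : q ∈ U) := hu.metricInner_covAlong_normal_push hw hnormal hq
  have ds : DifferentiableAt ℝ (principalCurvature G H u w) p :=
    differentiableAt_of_contDiffOn hu.isOpen
      (hu.contDiffOn_metricInner hw (hu.contDiffOn_meanCurvature hu.metricSource)) hp
  have derivative := hu.pd_metricInner (hu.contDiffOn_covAlong hw j) (hu.contDiffOn_push k) hp i
  have dG := hu.metricSource.differentiableAt hp j k
  rw [pd_congr (g := fun q => -1 * (G q j k * principalCurvature G H u w q)) hu.isOpen hp
      (fun q hq => (weingarten hq j k).trans (neg_one_mul _).symm),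
    pd_mul _ (differentiableAt_const _) (dG.fun_mul ds), pd_const, pd_mul _ dG ds,
    hu.metricInner_covAlong_push hp, hu.metricSource.pd_eq_sum_christoffel hp] at derivative
  have factor : ∑ l, christoffel G l i k p * -(G p j l * principalCurvature G H u w p) =
      -((∑ l, G p j l * christoffel G l i k p) * principalCurvature G H u w p) := by
    rw [Finset.sum_mul, ← Finset.sum_neg_distrib]
    exact Finset.sum_congr rfl fun l _ => by ring
  simp only [weingarten hp, Finset.sum_add_distrib, factor] at derivative
  simp only [hessianAlong, metricInner_sub_left, metricInner_sum_left, metricInner_smul_left,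
    weingarten hp, mul_neg, Finset.sum_neg_distrib, ← mul_assoc, ← Finset.sum_mul]
  linarith

lemma metricInner_curvatureOperator_push (hu : IsUmbilicOn G H V u U) (hw : ContDiffOn ℝ ∞ w U)
    (hnormal : IsNormalOn H u w U) (hp : p ∈ U) (i j k : Fin m) :
    metricInner H (u p) (curvatureOperator H (u p) (push u i p) (w p) (push u j p)) (push u k p) =
      G p i k * (pd j (principalCurvature G H u w) p -
          metricInner H (u p) (covAlong H u j w p) (meanCurvature G H u p)) -
        G p i j * (pd k (principalCurvature G H u w) p -
          metricInner H (u p) (covAlong H u k w p) (meanCurvature G H u p)) := by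
  rw [hu.metric.metricInner_curvatureOperator_pair_symm (hu.mapsTo hp),
    hu.metric.metricInner_curvatureOperator_skew (hu.mapsTo hp),
    ← hu.hessianAlong_sub_hessianAlong hu.metricSource hw hp, metricInner_sub_left,
    hu.metricInner_hessianAlong_push hw hnormal hp, hu.metricInner_hessianAlong_push hw hnormal hp,
    hu.metricSource.symm hp k i, hu.metricSource.symm hp j i]
  ring

lemma metricInner_jacobiOperator_push (hu : IsUmbilicOn G H V u U) (hw : ContDiffOn ℝ ∞ w U)
    (hnormal : IsNormalOn H u w U) (hp : p ∈ U) (k : Fin m) :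
    metricInner H (u p) (jacobiOperator G H u w p) (push u k p) =
      (m - 2) * pd k (principalCurvature G H u w) p -
        m * metricInner H (u p) (covAlong H u k w p) (meanCurvature G H u p) := by
  have hG := hu.metricSource.posDef p hp
  simp only [metricInner_jacobiOperator, hu.metricInner_hessianAlong_push hw hnormal hp,
    hu.metricInner_curvatureOperator_push hw hnormal hp, metricTrace_sub, metricTrace_neg]
  simp only [← smul_eq_mul (G p _ _)]
  rw [metricTrace_metric_smul_left hG, metricTrace_metric_smul_right hG,
    metricTrace_metric_smul_right hG, metricTrace_smul_const (fun i j => G p i j),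
    metricTrace_metric hG, Fintype.card_fin, smul_eq_mul]
  ring

/-- The tangential part of `∇w` alone contributes `m ⟨w, η⟩²` to the energy `|∇w|²`. -/
lemma mul_sq_principalCurvature_le (hu : IsUmbilicOn G H V u U) (hw : ContDiffOn ℝ ∞ w U)
    (hnormal : IsNormalOn H u w U) (hp : p ∈ U) :
    m * principalCurvature G H u w p ^ 2 ≤
      metricTrace (G p) fun i j =>
        metricInner H (u p) (covAlong H u i w p) (covAlong H u j w p) := by
  have hG := hu.metricSource.posDef p hp
  set s := principalCurvature G H u w p
  have expand (i j : Fin m) :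
      metricInner H (u p) (covAlong H u i w p + s • push u i p)
          (covAlong H u j w p + s • push u j p) =
        metricInner H (u p) (covAlong H u i w p) (covAlong H u j w p) - s ^ 2 • G p i j := by
    simp only [metricInner_add_left, metricInner_add_right, metricInner_smul_left,
      metricInner_smul_right, hu.metricInner_comm hp (push u i p) (covAlong H u j w p),
      hu.metricInner_covAlong_normal_push hw hnormal hp, ← hu.isometric p hp,
      hu.metricSource.symm hp j i, smul_eq_mul]
    ring
  have nonneg := metricTrace_nonneg hG (Matrix.toBilin' (H (u p)))
    (fun X => by
      simpa only [metricInner_eq_toBilin'] using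
        hu.metric.metricInner_self_nonneg (hu.mapsTo hp) X)
    (fun i => covAlong H u i w p + s • push u i p)
  simp only [← metricInner_eq_toBilin', expand, metricTrace_sub] at nonneg
  rw [metricTrace_smul _ fun i j => G p i j, metricTrace_metric hG, Fintype.card_fin,
    smul_eq_mul] at nonneg
  linarith

/-- Half the Laplacian of `|w|²`, which vanishes, is the energy `|∇w|²` plus a curvature term that
is nonnegative. -/
lemma principalCurvature_eq_zero (hm : m ≠ 0) (hu : IsUmbilicOn G H V u U)
    (hsec : NonpositivelyCurvedOn H V) (hw : ContDiffOn ℝ ∞ w U) (hnormal : IsNormalOn H u w U)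
    (hjacobi : ∀ q ∈ U, jacobiOperator G H u w q = 0)
    (hconst : ∀ q ∈ U, ∀ k, metricInner H (u q) (covAlong H u k w q) (w q) = 0) (hp : p ∈ U) :
    principalCurvature G H u w p = 0 := by
  have bochner := metricInner_jacobiOperator (G := G) (H := H) (u := u) (p := p) (w := w) (w p)
  simp only [hjacobi p hp, hu.metricInner_hessianAlong_self hw hconst hp, metricTrace_neg]
    at bochner
  have curvature_nonneg := hsec.metricTrace_curvatureOperator_nonneg (hu.metricSource.posDef p hp)
    hu.metric (hu.mapsTo hp) (w p) fun i => push u i p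
  have energy := hu.mul_sq_principalCurvature_le hw hnormal hp
  have zero_left : metricInner H (u p) 0 (w p) = 0 := by simp [metricInner]
  have hm_pos : (0 : ℝ) < m := by positivity
  have : m * principalCurvature G H u w p ^ 2 ≤ 0 := by linarith
  exact pow_eq_zero_iff two_ne_zero |>.1 <|
    le_antisymm (nonpos_of_mul_nonpos_right this hm_pos) (sq_nonneg _)

end IsUmbilicOn

/-! ### Conformal changes of the metric -/

/-- The gradient of the function `c` with respect to the metric `G`, in coordinates. -/
noncomputable def metricGradient (G : Coord m → Matrix (Fin m) (Fin m) ℝ) (c : Coord m → ℝ)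
    (p : Coord m) (k : Fin m) : ℝ :=
  ∑ l, (G p)⁻¹ k l * pd l c p

/-- `G' = c G` on `U` with a smooth positive conformal factor `c`. -/
structure IsConformalOn (G G' : Coord m → Matrix (Fin m) (Fin m) ℝ) (c : Coord m → ℝ)
    (U : Set (Coord m)) : Prop where
  metric : IsMetricOn G U
  contDiffOn : ContDiffOn ℝ ∞ c U
  pos : ∀ q ∈ U, 0 < c q
  eq_smul : ∀ q ∈ U, G' q = c q • G q

namespace IsConformalOn

variable {G G' : Coord m → Matrix (Fin m) (Fin m) ℝ} {c : Coord m → ℝ} {U : Set (Coord m)}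
  {p : Coord m}

lemma mono {W : Set (Coord m)} (h : IsConformalOn G G' c U) (hW : IsOpen W) (hWU : W ⊆ U) :
    IsConformalOn G G' c W where
  metric := h.metric.mono hW hWU
  contDiffOn := h.contDiffOn.mono hWU
  pos q hq := h.pos q (hWU hq)
  eq_smul q hq := h.eq_smul q (hWU hq)

lemma pd_metric (h : IsConformalOn G G' c U) (hp : p ∈ U) (k i j : Fin m) :
    pd k (fun q => G' q i j) p = pd k c p * G p i j + c p * pd k (fun q => G q i j) p := by
  rw [pd_congr h.metric.isOpen hp (g := fun q => c q * G q i j) fun q hq => by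
      simp only [h.eq_smul q hq, Matrix.smul_apply, smul_eq_mul],
    pd_mul k (differentiableAt_of_contDiffOn h.metric.isOpen h.contDiffOn hp)
      (h.metric.differentiableAt hp i j)]

lemma christoffel_eq (h : IsConformalOn G G' c U) (hp : p ∈ U) (k i j : Fin m) :
    christoffel G' k i j p = christoffel G k i j p + (2 * c p)⁻¹ *
      (pd i c p * (if k = j then 1 else 0) + pd j c p * (if k = i then 1 else 0) -
        G p i j * metricGradient G c p k) := by
  have hG := h.metric.posDef p hp
  have hc := (h.pos p hp).ne'
  have raise (a b : Fin m) : ∑ l, (G p)⁻¹ k l * (pd a c p * G p b l) =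
      pd a c p * (if k = b then 1 else 0) := by
    rw [← sum_inv_mul_of_posDef hG, Finset.mul_sum]
    exact Finset.sum_congr rfl fun l _ => by rw [h.metric.symm hp b l]; ring
  rw [← raise i j, ← raise j i]
  unfold christoffel metricGradient
  simp only [h.pd_metric hp, h.eq_smul p hp, inv_smul_of_posDef hG hc, Matrix.smul_apply,
    smul_eq_mul, Finset.mul_sum, ← Finset.sum_add_distrib, ← Finset.sum_sub_distrib]
  refine Finset.sum_congr rfl fun l _ => ?_
  field_simp
  ring

lemma metricTrace_christoffel (h : IsConformalOn G G' c U) (hp : p ∈ U) (k : Fin m) :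
    metricTrace (G' p) (fun i j => christoffel G' k i j p) =
      (c p)⁻¹ * (metricTrace (G p) (fun i j => christoffel G k i j p) +
        (2 * c p)⁻¹ * ((2 - m) * metricGradient G c p k)) := by
  have hG := h.metric.posDef p hp
  have trace_right : (metricTrace (G p) fun i j => pd j c p * (if k = i then (1 : ℝ) else 0)) =
      metricGradient G c p k := by
    rw [metricTrace, Finset.sum_comm]
    simp [metricGradient]
  have trace_left : (metricTrace (G p) fun i j => pd i c p * (if k = j then (1 : ℝ) else 0)) =
      metricGradient G c p k := by
    rw [← trace_right, ← metricTrace_swap hG]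
  have trace_metric : (metricTrace (G p) fun i j => G p i j * metricGradient G c p k) =
      m * metricGradient G c p k := by
    simpa only [metricTrace_metric hG, Fintype.card_fin, smul_eq_mul] using
      metricTrace_smul_const (g := G p) (fun i j => G p i j) (metricGradient G c p k)
  rw [h.eq_smul p hp, metricTrace_smul_metric hG (h.pos p hp).ne', smul_eq_mul]
  simp only [h.christoffel_eq hp, metricTrace_add, ← smul_eq_mul (2 * c p)⁻¹, metricTrace_smul,
    metricTrace_sub, trace_left, trace_right, trace_metric]
  simp only [smul_eq_mul]
  ring

end IsConformalOn

/-! ### Conformal changes in dimension two -/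

section Surface

variable {G G' : Coord 2 → Matrix (Fin 2) (Fin 2) ℝ} {c : Coord 2 → ℝ} {U : Set (Coord 2)}
  {H : Coord n → Matrix (Fin n) (Fin n) ℝ} {V : Set (Coord n)} {u : Coord 2 → Coord n}
  {w : Coord 2 → Fin n → ℝ} {p : Coord 2}

namespace IsConformalOn

lemma metricTrace_sub_christoffel {E : Type*} [AddCommGroup E] [Module ℝ E]
    (h : IsConformalOn G G' c U) (hp : p ∈ U) (T : Fin 2 → Fin 2 → E) (v : Fin 2 → E) :
    metricTrace (G' p) (fun i j => T i j - ∑ k, christoffel G' k i j p • v k) =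
      (c p)⁻¹ • metricTrace (G p) (fun i j => T i j - ∑ k, christoffel G k i j p • v k) := by
  simp only [metricTrace_sub, metricTrace_sum, metricTrace_smul_const,
    h.metricTrace_christoffel hp, Nat.cast_ofNat, sub_self, zero_mul, mul_zero, add_zero, mul_smul,
    ← Finset.smul_sum, smul_sub]
  rw [h.eq_smul p hp, metricTrace_smul_metric (h.metric.posDef p hp) (h.pos p hp).ne']

lemma tension_eq (h : IsConformalOn G G' c U) (hp : p ∈ U) :
    tension G' H u p = (c p)⁻¹ • tension G H u p := by
  simp only [tension_eq_metricTrace, secondForm_eq_covAlong_sub]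
  exact h.metricTrace_sub_christoffel hp _ _

lemma jacobiOperator_eq (h : IsConformalOn G G' c U) (hp : p ∈ U) :
    jacobiOperator G' H u w p = (c p)⁻¹ • jacobiOperator G H u w p := by
  simp only [jacobiOperator, hessianAlong, smul_sub]
  rw [h.metricTrace_sub_christoffel hp, h.eq_smul p hp,
    metricTrace_smul_metric (h.metric.posDef p hp) (h.pos p hp).ne']

lemma contDiffOn_tension (h : IsConformalOn G G' c U) (hu : IsMapOn H V u U) :
    ContDiffOn ℝ ∞ (tension G' H u) U :=
  ((h.contDiffOn.inv fun q hq => (h.pos q hq).ne').smul (hu.contDiffOn_tension h.metric)).congr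
    fun _ hq => h.tension_eq hq

end IsConformalOn

lemma IsUmbilicOn.metricInner_covAlong_meanCurvature (hu : IsUmbilicOn G H V u U)
    (hw : ContDiffOn ℝ ∞ w U) (hnormal : IsNormalOn H u w U) (hp : p ∈ U)
    (hjacobi : jacobiOperator G H u w p = 0) (k : Fin 2) :
    metricInner H (u p) (covAlong H u k w p) (meanCurvature G H u p) = 0 := by
  have tangential := hu.metricInner_jacobiOperator_push hw hnormal hp k
  rw [hjacobi, show metricInner H (u p) 0 (push u k p) = 0 by simp [metricInner],
    Nat.cast_ofNat, sub_self, zero_mul, zero_sub] at tangential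
  linarith

theorem IsUmbilicOn.tension_eq_zero_of_bitension_eq_zero (hu : IsUmbilicOn G H V u U)
    (hconf : IsConformalOn G G' c U) (hsec : NonpositivelyCurvedOn H V)
    (hbi : ∀ q ∈ U, bitension G' H u q = 0) (hp : p ∈ U) : tension G H u p = 0 := by
  set w := tension G' H u
  have w_eq {q : Coord 2} (hq : q ∈ U) : w q = (c q)⁻¹ • tension G H u q := hconf.tension_eq hq
  have w_eq_meanCurvature {q : Coord 2} (hq : q ∈ U) :
      w q = (2 * (c q)⁻¹) • meanCurvature G H u q := by
    rw [w_eq hq, meanCurvature, smul_smul]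
    congr 1
    push_cast
    ring
  have hw : ContDiffOn ℝ ∞ w U := hconf.contDiffOn_tension hu.toIsMapOn
  have hnormal : IsNormalOn H u w U := fun q hq k => by
    rw [w_eq hq, metricInner_smul_left, hu.isNormalOn_tension q hq, mul_zero]
  have hjacobi (q : Coord 2) (hq : q ∈ U) : jacobiOperator G H u w q = 0 := by
    have := hbi q hq
    rw [bitension_eq_jacobiOperator_tension, hconf.jacobiOperator_eq hq] at this
    exact (smul_eq_zero_iff_right (inv_ne_zero (hconf.pos q hq).ne')).1 this
  have hconst (q : Coord 2) (hq : q ∈ U) (k : Fin 2) :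
      metricInner H (u q) (covAlong H u k w q) (w q) = 0 := by
    rw [w_eq_meanCurvature hq, metricInner_smul_right,
      hu.metricInner_covAlong_meanCurvature hw hnormal hq (hjacobi q hq), mul_zero]
  have hs := hu.principalCurvature_eq_zero two_ne_zero hsec hw hnormal hjacobi hconst hp
  rw [principalCurvature, w_eq_meanCurvature hp, metricInner_smul_left, mul_eq_zero] at hs
  have hη : meanCurvature G H u p = 0 := by
    by_contra hne
    exact hs.elim (mul_pos two_pos (inv_pos.2 (hconf.pos p hp))).ne'
      (hu.metric.metricInner_self_pos (hu.mapsTo hp) hne).ne'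
  simpa [meanCurvature] using hη

end Surface

end LocalGeom

/-! ### Metrics and maps in charts -/

section ChartDomain

variable {m n : ℕ} {M N : Type*} [TopologicalSpace M] [TopologicalSpace N]

/-- The domain of the coordinate expression `mapInCharts φ e e'`. -/
def chartDomain (φ : M → N) (e : OpenPartialHomeomorph M (Coord m))
    (e' : OpenPartialHomeomorph N (Coord n)) : Set (Coord m) :=
  e.target ∩ (fun p => φ (e.symm p)) ⁻¹' e'.source

lemma isOpen_chartDomain {e : OpenPartialHomeomorph M (Coord m)}
    {e' : OpenPartialHomeomorph N (Coord n)} {φ : M → N} (hφ : Continuous φ) :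
    IsOpen (chartDomain φ e e') :=
  (hφ.comp_continuousOn e.symm.continuousOn).isOpen_inter_preimage e.open_target e'.open_source

end ChartDomain

section Charts

variable {m n : ℕ}
  {M : Type*} [TopologicalSpace M] [ChartedSpace (Coord m) M]
  {N : Type*} [TopologicalSpace N] [ChartedSpace (Coord n) N]
  {e : OpenPartialHomeomorph M (Coord m)} {e' : OpenPartialHomeomorph N (Coord n)}
  {φ : M → N} {p : Coord m}

lemma contMDiff_coordSection (i : Fin m) : ContMDiff (𝓡 m) (𝓡 m).tangent ∞ fun p : Coord m =>
    (⟨p, EuclideanSpace.single i (1 : ℝ)⟩ : TangentBundle (𝓡 m) (Coord m)) := by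
  intro p
  rw [Bundle.contMDiffAt_totalSpace]
  exact ⟨contMDiffAt_id, by simpa using contMDiffAt_const⟩

lemma mfderiv_symm_eq_sum (e : OpenPartialHomeomorph M (Coord m)) (p v : Coord m) :
    mfderiv (𝓡 m) (𝓡 m) e.symm p v = ∑ i, v i • coordVector e i p := by
  set L : Coord m →L[ℝ] TangentSpace (𝓡 m) (e.symm p) := mfderiv (𝓡 m) (𝓡 m) e.symm p
  calc L v = L (∑ i, v i • EuclideanSpace.single i (1 : ℝ)) := by rw [LocalGeom.sum_smul_single]
    _ = ∑ i, v i • L (EuclideanSpace.single i (1 : ℝ)) := by simp only [map_sum, map_smul]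

namespace IsSmoothChart

lemma mdifferentiableAt_symm (he : IsSmoothChart m e) (hp : p ∈ e.target) :
    MDifferentiableAt (𝓡 m) (𝓡 m) e.symm p :=
  (contMDiffAt_symm_of_mem_maximalAtlas he hp).mdifferentiableAt (by simp)

lemma contMDiffOn_coordVector [IsManifold (𝓡 m) ∞ M] (he : IsSmoothChart m e) (i : Fin m) :
    ContMDiffOn (𝓡 m) (𝓡 m).tangent ∞
      (fun p => (⟨e.symm p, coordVector e i p⟩ : TangentBundle (𝓡 m) M)) e.target := by
  have tangentMap_smooth := (contMDiffOn_symm_of_mem_maximalAtlas he).contMDiffOn_tangentMapWithin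
    (m := ∞) (by simp) e.open_target.uniqueMDiffOn
  refine (tangentMap_smooth.comp (contMDiff_coordSection i).contMDiffOn (s := e.target)
    fun _ hp => hp).congr fun p hp => ?_
  simp only [Function.comp, tangentMapWithin, coordVector]
  rw [mfderivWithin_of_isOpen e.open_target hp]

lemma mfderiv_symm_ne_zero [IsManifold (𝓡 m) ∞ M] (he : IsSmoothChart m e) (hp : p ∈ e.target)
    {v : Coord m} (hv : v ≠ 0) : mfderiv (𝓡 m) (𝓡 m) e.symm p v ≠ 0 := by
  have he_diff : MDifferentiableAt (𝓡 m) (𝓡 m) e (e.symm p) :=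
    (contMDiffAt_of_mem_maximalAtlas he (e.map_target hp)).mdifferentiableAt (by simp)
  have right_inv : e ∘ e.symm =ᶠ[nhds p] id :=
    Filter.eventually_of_mem (e.open_target.mem_nhds hp) fun q hq => e.right_inv hq
  have chain := mfderiv_comp p he_diff (he.mdifferentiableAt_symm hp)
  rw [right_inv.mfderiv_eq, mfderiv_id] at chain
  have hv_eq : v = mfderiv (𝓡 m) (𝓡 m) e (e.symm p) (mfderiv (𝓡 m) (𝓡 m) e.symm p v) :=
    congrArg (fun L : TangentSpace (𝓡 m) p →L[ℝ] TangentSpace (𝓡 m) p => L v) chain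
  intro hzero
  rw [hzero, map_zero] at hv_eq
  exact hv hv_eq

end IsSmoothChart

section Metric

variable [IsManifold (𝓡 m) ∞ M] (g : SmoothMetric m M)

lemma inner_mfderiv_symm (e : OpenPartialHomeomorph M (Coord m)) (p v w : Coord m) :
    g.inner (e.symm p) (mfderiv (𝓡 m) (𝓡 m) e.symm p v) (mfderiv (𝓡 m) (𝓡 m) e.symm p w) =
      LocalGeom.metricInner (metricInChart g e) p v w := by
  rw [mfderiv_symm_eq_sum, mfderiv_symm_eq_sum]
  simp only [map_sum, map_smul, sum_apply, smul_apply, smul_eq_mul, LocalGeom.metricInner,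
    metricInChart, Matrix.of_apply, Finset.mul_sum]
  rw [Finset.sum_comm]
  exact Finset.sum_congr rfl fun i _ => Finset.sum_congr rfl fun j _ => by ring

lemma contDiffOn_metricInChart (he : IsSmoothChart m e) (i j : Fin m) :
    ContDiffOn ℝ ∞ (fun p => metricInChart g e p i j) e.target := by
  have metric_smooth : ContMDiffOn (𝓡 m) ((𝓡 m).prod 𝓘(ℝ, Coord m →L[ℝ] Coord m →L[ℝ] ℝ)) ∞
      (fun p => Bundle.TotalSpace.mk' (Coord m →L[ℝ] Coord m →L[ℝ] ℝ)
        (E := fun x : M => TangentSpace (𝓡 m) x →L[ℝ] TangentSpace (𝓡 m) x →L[ℝ] ℝ)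
        (e.symm p) (g.inner (e.symm p))) e.target :=
    g.contMDiff.comp_contMDiffOn (contMDiffOn_symm_of_mem_maximalAtlas he)
  intro p hp
  have pairing_smooth : ContMDiffWithinAt (𝓡 m) ((𝓡 m).prod 𝓘(ℝ)) ∞
      (fun p => Bundle.TotalSpace.mk' ℝ (E := Bundle.Trivial M ℝ) (e.symm p)
        (g.inner (e.symm p) (coordVector e i p) (coordVector e j p))) e.target p :=
    ContMDiffWithinAt.clm_bundle_apply₂ (F₁ := Coord m) (F₂ := Coord m) (metric_smooth p hp)
      (he.contMDiffOn_coordVector i p hp) (he.contMDiffOn_coordVector j p hp)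
  rw [Bundle.contMDiffWithinAt_totalSpace] at pairing_smooth
  exact pairing_smooth.2.contDiffWithinAt

lemma posDef_metricInChart (he : IsSmoothChart m e) (hp : p ∈ e.target) :
    (metricInChart g e p).PosDef := by
  refine Matrix.PosDef.of_dotProduct_mulVec_pos ?_ fun x hx => ?_
  · ext i j
    simp [metricInChart, g.symm]
  · have hx' : (WithLp.toLp 2 x : Coord m) ≠ 0 := by simpa using hx
    have hpos := g.pos _ _ (he.mfderiv_symm_ne_zero hp hx')
    rwa [inner_mfderiv_symm, LocalGeom.metricInner_eq_toBilin', Matrix.toBilin'_apply'] at hpos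

lemma isMetricOn_metricInChart (he : IsSmoothChart m e) :
    LocalGeom.IsMetricOn (metricInChart g e) e.target where
  isOpen := e.open_target
  contDiffOn := contDiffOn_metricInChart g he
  posDef _ := posDef_metricInChart g he

end Metric

lemma contDiffOn_mapInCharts (he : IsSmoothChart m e) (he' : IsSmoothChart n e')
    (hφ : ContMDiff (𝓡 m) (𝓡 n) ∞ φ) :
    ContDiffOn ℝ ∞ (mapInCharts φ e e') (chartDomain φ e e') := by
  have hφe : ContMDiffOn (𝓡 m) (𝓡 n) ∞ (fun p => φ (e.symm p)) (chartDomain φ e e') :=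
    hφ.comp_contMDiffOn ((contMDiffOn_symm_of_mem_maximalAtlas he).mono Set.inter_subset_left)
  have : ContMDiffOn (𝓡 m) (𝓡 n) ∞ (mapInCharts φ e e') (chartDomain φ e e') :=
    (contMDiffOn_of_mem_maximalAtlas he').comp hφe fun p hp => hp.2
  exact this.contDiffOn

lemma mfderiv_coordVector (he : IsSmoothChart m e) (he' : IsSmoothChart n e')
    (hφ : ContMDiff (𝓡 m) (𝓡 n) ∞ φ) (hp : p ∈ chartDomain φ e e') (i : Fin m) :
    (mfderiv (𝓡 m) (𝓡 n) φ (e.symm p) (coordVector e i p) : Coord n) =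
      mfderiv (𝓡 n) (𝓡 n) e'.symm (mapInCharts φ e e' p)
        (WithLp.toLp 2 (LocalGeom.push (mapInCharts φ e e') i p) : Coord n) := by
  have hopen : chartDomain φ e e' ∈ nhds p := (isOpen_chartDomain hφ.continuous).mem_nhds hp
  have hu : DifferentiableAt ℝ (mapInCharts φ e e') p :=
    ((contDiffOn_mapInCharts he he' hφ).contDiffAt hopen).differentiableAt (by simp)
  have factor : φ ∘ e.symm =ᶠ[nhds p] e'.symm ∘ mapInCharts φ e e' :=
    Filter.eventually_of_mem hopen fun q hq => (e'.left_inv hq.2).symm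
  have chain := mfderiv_comp p (hφ.mdifferentiableAt (by simp)) (he.mdifferentiableAt_symm hp.1)
  rw [factor.mfderiv_eq, mfderiv_comp p (he'.mdifferentiableAt_symm (e'.map_source hp.2))
    hu.mdifferentiableAt, mfderiv_eq_fderiv] at chain
  rw [LocalGeom.toLp_push hu]
  exact (congrArg (fun L : Coord m →L[ℝ] Coord n => L (EuclideanSpace.single i 1)) chain).symm

lemma isMapOn_mapInCharts [IsManifold (𝓡 n) ∞ N] (h : SmoothMetric n N) (he : IsSmoothChart m e)
    (he' : IsSmoothChart n e') (hφ : ContMDiff (𝓡 m) (𝓡 n) ∞ φ) :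
    LocalGeom.IsMapOn (metricInChart h e') e'.target (mapInCharts φ e e')
      (chartDomain φ e e') where
  metric := isMetricOn_metricInChart h he'
  isOpen := isOpen_chartDomain hφ.continuous
  contDiffOn := contDiffOn_mapInCharts he he' hφ
  mapsTo _ hp := e'.map_source hp.2

section Immersion

variable [IsManifold (𝓡 m) ∞ M] [IsManifold (𝓡 n) ∞ N] {g : SmoothMetric m M}
  {h : SmoothMetric n N}

lemma IsIsometricImmersion.metricInChart_eq (hiso : IsIsometricImmersion g h φ)
    (he : IsSmoothChart m e) (he' : IsSmoothChart n e') (hp : p ∈ chartDomain φ e e')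
    (j k : Fin m) :
    metricInChart g e p j k = LocalGeom.metricInner (metricInChart h e') (mapInCharts φ e e' p)
      (LocalGeom.push (mapInCharts φ e e') j p) (LocalGeom.push (mapInCharts φ e e') k p) := by
  have inner_push := inner_mfderiv_symm h e' (mapInCharts φ e e' p)
    (WithLp.toLp 2 (LocalGeom.push (mapInCharts φ e e') j p))
    (WithLp.toLp 2 (LocalGeom.push (mapInCharts φ e e') k p))
  rw [← mfderiv_coordVector he he' hiso.1 hp, ← mfderiv_coordVector he he' hiso.1 hp,
    show e'.symm (mapInCharts φ e e' p) = φ (e.symm p) from e'.left_inv hp.2] at inner_push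
  rw [metricInChart, Matrix.of_apply, ← hiso.2]
  exact inner_push

lemma IsIsometricImmersion.isIsometricOn (hiso : IsIsometricImmersion g h φ)
    (he : IsSmoothChart m e) (he' : IsSmoothChart n e') :
    LocalGeom.IsIsometricOn (metricInChart g e) (metricInChart h e') e'.target
      (mapInCharts φ e e') (chartDomain φ e e') where
  toIsMapOn := isMapOn_mapInCharts h he he' hiso.1
  metricSource := (isMetricOn_metricInChart g he).mono (isOpen_chartDomain hiso.1.continuous)
    Set.inter_subset_left
  isometric _ hq := hiso.metricInChart_eq he he' hq

lemma IsTotallyUmbilical.isUmbilicOn (humb : IsTotallyUmbilical g h φ)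
    (hiso : IsIsometricImmersion g h φ) (he : IsSmoothChart m e) (he' : IsSmoothChart n e') :
    LocalGeom.IsUmbilicOn (metricInChart g e) (metricInChart h e') e'.target
      (mapInCharts φ e e') (chartDomain φ e e') where
  toIsIsometricOn := hiso.isIsometricOn he he'
  umbilic q hq i j := funext (humb e e' he he' q hq.1 hq.2 i j)

end Immersion

lemma IsConformalRescaling.isConformalOn [NeZero m] [IsManifold (𝓡 m) ∞ M]
    {g gbar : SmoothMetric m M} {lam : M → ℝ} (hconf : IsConformalRescaling g gbar lam)
    (he : IsSmoothChart m e) :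
    LocalGeom.IsConformalOn (metricInChart g e) (metricInChart gbar e)
      (fun q => (lam (e.symm q) ^ 2)⁻¹) e.target := by
  have scale (q : Coord m) :
      metricInChart gbar e q = (lam (e.symm q) ^ 2)⁻¹ • metricInChart g e q :=
    Matrix.ext fun _ _ => hconf.2 _ _ _
  have hg := isMetricOn_metricInChart g he
  refine ⟨hg, ?_, fun q _ => inv_pos.2 (pow_pos (hconf.1 _) 2), fun q _ => scale q⟩
  have diag_ne {q : Coord m} (hq : q ∈ e.target) : metricInChart g e q 0 0 ≠ 0 :=
    (hg.posDef q hq).diag_pos.ne'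
  refine ((contDiffOn_metricInChart gbar he 0 0).div (hg.contDiffOn 0 0)
    fun q hq => diag_ne hq).congr fun q hq => ?_
  rw [Pi.div_apply, scale, Matrix.smul_apply, smul_eq_mul, mul_div_cancel_right₀ _ (diag_ne hq)]

end Charts

theorem mainTheorem8_general
    {M : Type*} [TopologicalSpace M] [ChartedSpace (Coord 2) M] [IsManifold (𝓡 2) ∞ M]
    {n : ℕ} {N : Type*} [TopologicalSpace N] [ChartedSpace (Coord n) N] [IsManifold (𝓡 n) ∞ N]
    (g : SmoothMetric 2 M) (h : SmoothMetric n N) (φ : M → N)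
    (hN : NonpositivelyCurved h)
    (hiso : IsIsometricImmersion g h φ)
    (humb : IsTotallyUmbilical g h φ)
    (gbar : SmoothMetric 2 M) (lam : M → ℝ)
    (hconf : IsConformalRescaling g gbar lam)
    (hbi : IsBiharmonicMap gbar h φ) :
    IsHarmonicMap gbar h φ ∧ IsTotallyGeodesic g h φ := by
  have minimal : IsHarmonicMap g h φ := fun e e' he he' p hp hp' => by
    have hopen : IsOpen (chartDomain φ e e') := isOpen_chartDomain hiso.1.continuous
    refine congrFun <| (humb.isUmbilicOn hiso he he').tension_eq_zero_of_bitension_eq_zero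
      ((hconf.isConformalOn he).mono hopen Set.inter_subset_left) (hN e' he') (fun q hq => ?_)
      ⟨hp, hp'⟩
    exact funext (hbi e e' he he' q hq.1 hq.2)
  refine ⟨fun e e' he he' p hp hp' α => ?_, fun e e' he he' p hp hp' i j α => ?_⟩
  · rw [(hconf.isConformalOn he).tension_eq hp, Pi.smul_apply, minimal e e' he he' p hp hp',
      smul_zero]
  · rw [humb e e' he he' p hp hp', minimal e e' he he' p hp hp', mul_zero, mul_zero]

theorem mainTheorem8
    {M : Type*} [TopologicalSpace M] [ChartedSpace (Coord 2) M] [IsManifold (𝓡 2) ∞ M]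
    {N : Type*} [TopologicalSpace N] [ChartedSpace (Coord 3) N] [IsManifold (𝓡 3) ∞ N]
    (g : SmoothMetric 2 M) (h : SmoothMetric 3 N) (φ : M → N)
    (hN : NonpositivelyCurved h)
    (hiso : IsIsometricImmersion g h φ)
    (humb : IsTotallyUmbilical g h φ)
    (gbar : SmoothMetric 2 M) (lam : M → ℝ)
    (hconf : IsConformalRescaling g gbar lam)
    (hbi : IsBiharmonicMap gbar h φ) :
    IsHarmonicMap gbar h φ ∧ IsTotallyGeodesic g h φ :=
  mainTheorem8_general g h φ hN hiso humb gbar lam hconf hbi
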